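/- Let $\mathbb T=\mathbb R/2\pi\mathbb Z$. For $f:\mathbb T\to\mathbb R$ let $\widehat f(k)=\int_{\mathbb T}f(x)e^{-ikx}\,dx$, let $\|f\|_{H^1}^2=\|f\|_{L^2}^2+\frac1{2\pi}\sum_{k\in\mathbb Z}k^2|\widehat f(k)|^2$, and let $H^1(\mathbb T)$ be the set of $f\in L^2(\mathbb T)$ for which this is finite. For $\nu>0$, an integer $M\ge 2$ and $t\in\mathbb R$ of either sign define: - $S_L(t)=\exp(\nu t\,\partial_{xx})$, which multiplies $\widehat f(k)$ by $e^{-\nu t k^2}$, and $\Pi_M f=\frac1{2\pi}\sum_{|k|\le M}\widehat f(k)e^{ikx}$; - $S_N(t)b=w(t)$, where $w$ solves, at each point of $\mathbb T$, $\partial_s w=w-w^3$, $w(0)=b$ on the closed time interval between $0$ and $t$; for $t<0$ the solution may blow up before time $t$, and then $S_N(t)b$ is undefined; - $S^{(2)}(t)=\Pi_M S_L(\tfrac t2)\,S_N(t)\,\Pi_M S_L(\tfrac t2)$ and $S^{(4)}(t)=S^{(2)}(x_1t)\,S^{(2)}(-x_0t)\,S^{(2)}(x_1t)$, with $x_0=\frac{2^{1/3}}{2-2^{1/3}}$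 and $x_1=\frac1{2-2^{1/3}}$. Theorem. For all $\nu>0$, $l_0>0$ and $\gamma_1\in\mathbb R$ there are constants $\tau_*>0$ and $F^{(0)}>0$, depending only on $(\nu,l_0,\gamma_1)$, with the following property. Let $M\ge2$ be an integer, let $0<\tau\le l_0M^{-2}$ and $\tau\le\tau_*$, and let $a\in H^1(\mathbb T)$ be real valued with $\|a\|_{H^1}\le\gamma_1$. Then the iteration $$u^0=\Pi_M a,\qquad u^{n+1}=S^{(4)}(\tau)u^n\quad(n\ge0)$$ is well defined for all $n\ge 0$, and $$\sup_{n\ge1}\|u^n\|_{H^1(\mathbb T)}\le F^{(0)}.$$ -/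

import Mathlib

open scoped Real

noncomputable section

namespace AllenCahnSplitting

/-- The `2π`-periodic one-dimensional torus; its `volume` is Lebesgue measure, of total mass `2π`. -/
abbrev Torus : Type := AddCircle (2 * π)

instance fact_two_pi_pos : Fact (0 < 2 * π) := ⟨Real.two_pi_pos⟩

/-- The normalized Fourier coefficients `(2π)⁻¹ ∫ f(x) e^{-ikx} dx` of a real function
on the torus. -/
def coeff (f : Torus → ℝ) : ℤ → ℂ :=
  fourierCoeff (fun x => (f x : ℂ))

/-- The `L²` based Sobolev space `H¹`: `f` and `|∇| f` are in `L²`, where `|∇|` is the Fourier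
multiplier `|k|`. -/
def MemH1 (f : Torus → ℝ) : Prop :=
  MeasureTheory.MemLp f 2 MeasureTheory.volume ∧
    Summable (fun k : ℤ => (k : ℝ) ^ 2 * ‖coeff f k‖ ^ 2)

/-- `‖f‖_{H¹} = (‖f‖₂² + ‖|∇| f‖₂²)^{1/2}`, the second norm being written by Parseval as
`2π ∑ k² |c_k|²` with `c_k` the normalized Fourier coefficients. -/
def normH1 (f : Torus → ℝ) : ℝ :=
  Real.sqrt ((∫ x, f x ^ 2) + 2 * π * ∑' k : ℤ, (k : ℝ) ^ 2 * ‖coeff f k‖ ^ 2)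

/-- The linear propagator `S_L(t) = exp(ν t ∂ₓₓ)`, for `t` of either sign, acting on Fourier
coefficients. (For `t < 0` the resulting series need not be that of a function.) -/
def SL (ν t : ℝ) (c : ℤ → ℂ) : ℤ → ℂ :=
  fun k => (Real.exp (-(ν * t * (k : ℝ) ^ 2)) : ℂ) * c k

/-- The spectral cut-off `∑_{|k| ≤ M} c_k e^{ikx}` of the Fourier series with coefficients `c`.
For the coefficients used below `c (-k)` is the conjugate of `c k`, so that the sum is real. -/
def cutoff (M : ℕ) (c : ℤ → ℂ) : Torus → ℝ :=
  fun x => (∑ k ∈ Finset.Icc (-(M : ℤ)) (M : ℤ), c k * fourier k x).re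

/-- The projection `Π_M`. -/
def proj (M : ℕ) (f : Torus → ℝ) : Torus → ℝ :=
  cutoff M (coeff f)

/-- The nonlinear propagator: `w = S_N(t) b`, for `t` of either sign. At every point `x` the
solution `φ` of `φ' = φ - φ³`, `φ(0) = b x` exists on the whole closed time interval between
`0` and `t`, and its value at time `t` is `w x`. (For `t < 0` the solution may blow up before
time `t`, and then there is no such `w`.) -/
def IsSN (t : ℝ) (b w : Torus → ℝ) : Prop :=
  ∀ x, ∃ φ : ℝ → ℝ, φ 0 = b x ∧ φ t = w x ∧
    ∀ s ∈ Set.uIcc 0 t, HasDerivWithinAt φ (φ s - φ s ^ 3) (Set.uIcc 0 t) s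

/-- `v = S⁽²⁾(t) u`, where `S⁽²⁾(t) = Π_M S_L(t/2) S_N(t) Π_M S_L(t/2)`. -/
def IsS2 (ν : ℝ) (M : ℕ) (t : ℝ) (u v : Torus → ℝ) : Prop :=
  ∃ w : Torus → ℝ, IsSN t (cutoff M (SL ν (t / 2) (coeff u))) w ∧
    v = cutoff M (SL ν (t / 2) (coeff w))

def x₀ : ℝ := (2 : ℝ) ^ (1 / 3 : ℝ) / (2 - (2 : ℝ) ^ (1 / 3 : ℝ))

def x₁ : ℝ := 1 / (2 - (2 : ℝ) ^ (1 / 3 : ℝ))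

/-- `v = S⁽⁴⁾(τ) u`, where `S⁽⁴⁾(τ) = S⁽²⁾(x₁τ) S⁽²⁾(-x₀τ) S⁽²⁾(x₁τ)`. -/
def IsS4 (ν : ℝ) (M : ℕ) (τ : ℝ) (u v : Torus → ℝ) : Prop :=
  ∃ p q : Torus → ℝ,
    IsS2 ν M (x₁ * τ) u p ∧ IsS2 ν M (-x₀ * τ) p q ∧ IsS2 ν M (x₁ * τ) q v

/-- `u` is the sequence of iterates `u⁰ = Π_M a`, `uⁿ⁺¹ = S⁽⁴⁾(τ) uⁿ`. -/
def IsOrbit (ν : ℝ) (M : ℕ) (τ : ℝ) (a : Torus → ℝ) (u : ℕ → Torus → ℝ) : Prop :=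
  u 0 = proj M a ∧ ∀ n, IsS4 ν M τ (u n) (u (n + 1))

end AllenCahnSplitting

end

/-! ### Fourier coefficients and trigonometric polynomials on the torus -/

noncomputable section

namespace AllenCahnSplitting

open MeasureTheory AddCircle ComplexConjugate

/-! The scheme almost dissipates the Ginzburg–Landau energy, and this survives the backward substep
because `τ M² ≤ l₀` keeps every heat factor on the modes `|k| ≤ M`, forward or backward, below `exp
(2νl₀)`. No high-order accuracy is needed: one full step only has to agree with exponential Euler,
`e^{-ντk²} û + τ F̂` with `F = u - u³`, up to `τ r` with `‖r‖² = O(τ)` in `ℓ²`. The predicate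
`Approx` records this for each partial product, and `Approx.step` propagates it through one Strang
factor. Since the three time fractions add up to `1`, `exists_isS4_approx` follows.

With `x = ντk²`, `φ = (1 - e^{-x})/x` and `g = νu'' + u - u³`, the increment of a step is `τφg + τ(r
+ (1 - φ)F)` mode by mode. Because `xφ ≤ 1`, the second-order term of the stiff part of the energy
consumes at most half of the first-order gain `τφ|g|²`, although `x` itself is not small. Hence
`Approx.energy_sub_le`: the energy changes by at most `τ(-c‖g‖² + Qτ)`.

For small `τ` this leaves two cases. If `‖g‖ > 1`, the energy does not increase. If `‖g‖ ≤ 1`,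
testing `g` against `u` shows that the energy is at most `1` (`energy_le_one_of_force`), hence at
most `2` after the step. So `{energy ≤ E}` is invariant for every `E ≥ 2` (`exists_isS4_energy_le`),
with a threshold on `τ` independent of `M` and of the number of steps. The energy and the `H¹` norm
control each other, which gives the uniform bound. -/

/-- The frequencies `|k| ≤ M`. -/
abbrev modes (M : ℕ) : Finset ℤ := Finset.Icc (-(M : ℤ)) (M : ℤ)

lemma neg_mem_modes {M : ℕ} {k : ℤ} : -k ∈ modes M ↔ k ∈ modes M := by
  simp only [modes, Finset.mem_Icc]; omega

lemma coeff_neg (f : Torus → ℝ) (k : ℤ) : coeff f (-k) = conj (coeff f k) := by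
  unfold coeff fourierCoeff
  rw [← integral_conj]
  congr 1
  ext x
  simp only [smul_eq_mul, map_mul, Complex.conj_ofReal]
  rw [fourier_neg (n := k), fourier_neg (n := -k), fourier_neg (n := k)]

lemma hasSum_sq_coeff {f : Torus → ℝ} (hf : MemLp f 2 volume) :
    HasSum (fun k => ‖coeff f k‖ ^ 2) (∫ x, f x ^ 2 ∂haarAddCircle) := by
  have h : MemLp (fun x => (f x : ℂ)) 2 haarAddCircle := hf.ofReal.haarAddCircle
  convert hasSum_sq_fourierCoeff h.toLp using 1
  · rw [fourierCoeff_congr_ae h.coeFn_toLp]; rfl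
  · refine integral_congr_ae ?_
    filter_upwards [h.coeFn_toLp] with x hx
    rw [hx]; simp

lemma memLp_of_continuous {f : Torus → ℝ} (hf : Continuous f) : MemLp f 2 volume := by
  obtain ⟨C, hC⟩ := (isCompact_univ.image hf).isBounded.exists_norm_le
  exact MemLp.of_bound hf.aestronglyMeasurable C
    (Filter.Eventually.of_forall fun x => hC _ ⟨x, trivial, rfl⟩)

lemma integrable_of_continuous {E : Type*} [NormedAddCommGroup E] {f : Torus → E}
    (hf : Continuous f) : Integrable f haarAddCircle :=
  hf.integrable_of_hasCompactSupport (HasCompactSupport.of_compactSpace f)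

lemma sum_sq_coeff_le {f : Torus → ℝ} (hf : MemLp f 2 volume) (s : Finset ℤ) :
    ∑ k ∈ s, ‖coeff f k‖ ^ 2 ≤ ∫ x, f x ^ 2 ∂haarAddCircle :=
  sum_le_hasSum s (fun _ _ => by positivity) (hasSum_sq_coeff hf)

lemma integral_haar_eq (f : Torus → ℝ) :
    ∫ x, f x = 2 * π * ∫ x, f x ∂haarAddCircle := by
  rw [integral_haarAddCircle, smul_eq_mul, ← mul_assoc,
    mul_inv_cancel₀ Real.two_pi_pos.ne', one_mul]

lemma integral_le_of_le {f : Torus → ℝ} (hf : Continuous f) {C : ℝ} (h : ∀ x, f x ≤ C) :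
    ∫ x, f x ∂haarAddCircle ≤ C := by
  have := integral_mono (μ := haarAddCircle) (integrable_of_continuous hf)
    (integrable_const C) h
  simpa using this

lemma continuous_cutoff (M : ℕ) (c : ℤ → ℂ) : Continuous (cutoff M c) := by
  unfold cutoff
  fun_prop

lemma norm_fourier_apply (k : ℤ) (x : Torus) : ‖fourier k x‖ = 1 := Circle.norm_coe _

lemma abs_cutoff_le (M : ℕ) (c : ℤ → ℂ) (x : Torus) :
    |cutoff M c x| ≤ ∑ k ∈ modes M, ‖c k‖ := by
  refine (Complex.abs_re_le_norm _).trans ((norm_sum_le _ _).trans (le_of_eq ?_))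
  exact Finset.sum_congr rfl fun k _ => by rw [norm_mul, norm_fourier_apply, mul_one]

/-- Conjugate symmetric sequences: the Fourier coefficients of real functions. -/
def ConjSymm (c : ℤ → ℂ) : Prop := ∀ k, c (-k) = conj (c k)

lemma conjSymm_coeff (f : Torus → ℝ) : ConjSymm (coeff f) := coeff_neg f

lemma ConjSymm.SL {c : ℤ → ℂ} (hc : ConjSymm c) (ν t : ℝ) : ConjSymm (SL ν t c) := by
  intro k
  simp [AllenCahnSplitting.SL, hc k, ← Complex.exp_conj]

/-- The frequencies `k` and `-k` contribute conjugate terms, so the real part in `cutoff` discards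
nothing. -/
lemma ofReal_cutoff {M : ℕ} {c : ℤ → ℂ} (hc : ConjSymm c) (x : Torus) :
    (cutoff M c x : ℂ) = ∑ k ∈ modes M, c k * fourier k x := by
  unfold cutoff
  rw [← Complex.conj_eq_iff_re, map_sum]
  refine Finset.sum_nbij' (fun k => -k) (fun k => -k) ?_ ?_ ?_ ?_ ?_
  · exact fun k hk => neg_mem_modes.2 hk
  · exact fun k hk => neg_mem_modes.2 hk
  · simp
  · simp
  · intro k _
    rw [map_mul, hc k, fourier_neg]

lemma coeff_cutoff {M : ℕ} {c : ℤ → ℂ} (hc : ConjSymm c) (k : ℤ) :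
    coeff (cutoff M c) k = if k ∈ modes M then c k else 0 := by
  have h : (fun x => (cutoff M c x : ℂ)) = ∑ j ∈ modes M, fun x => c j * fourier j x := by
    ext x; rw [ofReal_cutoff hc, Finset.sum_apply]
  unfold coeff
  rw [h, fourierCoeff.sum]
  · simp_rw [Finset.sum_apply, fourierCoeff.const_mul, fourierCoeff_fourier]
    simp [Pi.single_apply]
  · intro j _
    exact integrable_of_continuous (by fun_prop)

/-- Real trigonometric polynomials of degree at most `M`. -/
def IsTrig (M : ℕ) (u : Torus → ℝ) : Prop := proj M u = u

lemma isTrig_cutoff {M : ℕ} {c : ℤ → ℂ} (hc : ConjSymm c) : IsTrig M (cutoff M c) := by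
  unfold IsTrig proj
  ext x
  show (∑ k ∈ modes M, _ : ℂ).re = (∑ k ∈ modes M, _ : ℂ).re
  congr 1
  refine Finset.sum_congr rfl fun k hk => ?_
  rw [coeff_cutoff hc, if_pos hk]

variable {M : ℕ} {u : Torus → ℝ}

lemma IsTrig.continuous (hu : IsTrig M u) : Continuous u := by
  rw [← hu]; exact continuous_cutoff _ _

lemma IsTrig.coeff_eq_zero (hu : IsTrig M u) {k : ℤ} (hk : k ∉ modes M) : coeff u k = 0 := by
  rw [← hu, proj, coeff_cutoff (conjSymm_coeff u), if_neg hk]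

lemma IsTrig.abs_apply_le (hu : IsTrig M u) (x : Torus) : |u x| ≤ ∑ k ∈ modes M, ‖coeff u k‖ := by
  have := abs_cutoff_le M (coeff u) x
  rwa [← proj, hu] at this

lemma integral_mul_cutoff {f : Torus → ℝ} (hf : Continuous f) (M : ℕ) (c : ℤ → ℂ) :
    ∫ x, f x * cutoff M c x ∂haarAddCircle = ∑ k ∈ modes M, (conj (coeff f k) * c k).re := by
  have h : ∀ x, f x * cutoff M c x
      = ∑ k ∈ modes M, Complex.re (c k * (fourier k x * (f x : ℂ))) := by
    intro x
    rw [← Complex.re_sum, cutoff, ← Complex.re_ofReal_mul, Finset.mul_sum]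
    congr 1
    exact Finset.sum_congr rfl fun k _ => by ring
  simp_rw [h]
  rw [integral_finsetSum]
  · refine Finset.sum_congr rfl fun k _ => ?_
    have hi : Integrable (fun x : Torus => c k * (fourier k x * (f x : ℂ))) haarAddCircle :=
      integrable_of_continuous (by fun_prop)
    have := integral_re hi
    simp only [RCLike.re_to_complex] at this
    rw [this, integral_const_mul, ← coeff_neg, mul_comm]
    simp [coeff, fourierCoeff]
  · intro k _
    exact integrable_of_continuous (by fun_prop)

lemma IsTrig.integral_mul {f : Torus → ℝ} (hf : Continuous f) (hu : IsTrig M u) :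
    ∫ x, f x * u x ∂haarAddCircle = ∑ k ∈ modes M, (conj (coeff f k) * coeff u k).re := by
  rw [← integral_mul_cutoff hf, ← proj, hu]

lemma IsTrig.integral_sq (hu : IsTrig M u) :
    ∫ x, u x ^ 2 ∂haarAddCircle = ∑ k ∈ modes M, ‖coeff u k‖ ^ 2 := by
  refine (hasSum_sq_coeff (memLp_of_continuous hu.continuous)).unique (hasSum_sum_of_ne_finset_zero ?_)
  intro k hk
  simp [hu.coeff_eq_zero hk]

lemma coeff_add {f g : Torus → ℝ} (hf : Continuous f) (hg : Continuous g) (k : ℤ) :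
    coeff (fun x => f x + g x) k = coeff f k + coeff g k := by
  unfold coeff
  rw [← Pi.add_apply (fourierCoeff _), ← fourierCoeff.add]
  · congr 1; ext x; simp
  · exact integrable_of_continuous (by fun_prop)
  · exact integrable_of_continuous (by fun_prop)

lemma coeff_const_mul (f : Torus → ℝ) (a : ℝ) (k : ℤ) :
    coeff (fun x => a * f x) k = a * coeff f k := by
  unfold coeff
  rw [← fourierCoeff.const_mul]
  simp

lemma coeff_sub {f g : Torus → ℝ} (hf : Continuous f) (hg : Continuous g) (k : ℤ) :
    coeff (fun x => f x - g x) k = coeff f k - coeff g k := by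
  have := coeff_add hf (g := fun x => (-1) * g x) (by fun_prop) k
  rw [coeff_const_mul] at this
  simpa [sub_eq_add_neg] using this

lemma coeff_translate (f : Torus → ℝ) (h : Torus) (k : ℤ) :
    coeff (fun x => f (x + h)) k = fourier k h * coeff f k := by
  unfold coeff fourierCoeff
  rw [← integral_const_mul,
    ← integral_add_right_eq_self (μ := haarAddCircle) (fun x => fourier k h * _) h]
  congr 1
  ext x
  have : fourier (-k) x = fourier k h * fourier (-k) (x + h) := by
    have e : fourier (-k) (x + h) = fourier (-k) x * fourier (-k) h := by
      simp [fourier_apply, smul_add, toCircle_add]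
    rw [e, fourier_neg (n := k) (x := h)]
    have := Complex.mul_conj (fourier k h)
    rw [Complex.normSq_eq_norm_sq, norm_fourier_apply] at this
    calc _ = fourier (-k) x * (fourier k h * conj (fourier k h)) := by rw [this]; simp
      _ = _ := by ring
  simp only [smul_eq_mul]
  rw [this, mul_assoc]

lemma norm_sq_fourier_sub_one (k : ℤ) (h : ℝ) :
    ‖fourier k (h : Torus) - 1‖ ^ 2 = 2 - 2 * Real.cos (k * h) := by
  have : fourier k (h : Torus) = Complex.exp ((k * h : ℝ) * Complex.I) := by
    rw [fourier_coe_apply]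
    congr 1
    have := Real.pi_pos.ne'
    push_cast
    field_simp
  rw [this, ← Complex.normSq_eq_norm_sq, Complex.normSq_apply, Complex.sub_re, Complex.sub_im,
    Complex.exp_ofReal_mul_I_re, Complex.exp_ofReal_mul_I_im]
  simp only [Complex.one_re, Complex.one_im]
  nlinarith [Real.sin_sq_add_cos_sq (k * h)]

/-- If the increments of `g` are controlled by those of the trigonometric polynomial `u`, then
so is the low frequency part of the `H¹` seminorm. -/
lemma IsTrig.sum_sq_mul_coeff_le (hM : 1 ≤ M) (hu : IsTrig M u) {g : Torus → ℝ}
    (hg : Continuous g) {L : ℝ} (hL : ∀ x y, |g x - g y| ≤ L * |u x - u y|) :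
    ∑ k ∈ modes M, (k : ℝ) ^ 2 * ‖coeff g k‖ ^ 2
      ≤ 4 * L ^ 2 * ∑ k ∈ modes M, (k : ℝ) ^ 2 * ‖coeff u k‖ ^ 2 := by
  -- Translation differences replace derivatives, so `g` need only be continuous. With shift `1/M`,
  -- every `|k| ≤ M` has `|kh| ≤ 1 ≤ π`, whence `(kh)²/4 ≤ 2 - 2 cos (kh) ≤ (kh)²`; the ratio of
  -- these two bounds is the factor `4`.
  set h : ℝ := (M : ℝ)⁻¹ with hh
  have hM0 : (0 : ℝ) < M := by exact_mod_cast hM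
  have hh0 : 0 < h := by positivity
  have huc := hu.continuous
  have key : ∀ f : Torus → ℝ, Continuous f → ∀ k,
      ‖coeff (fun x => f (x + (h : Torus)) - f x) k‖ ^ 2
        = (2 - 2 * Real.cos (k * h)) * ‖coeff f k‖ ^ 2 := by
    intro f hf k
    rw [coeff_sub (by fun_prop) hf, coeff_translate, ← norm_sq_fourier_sub_one, ← mul_pow,
      ← norm_mul]
    congr 2; ring
  have h1 : ∑ k ∈ modes M, (2 - 2 * Real.cos (k * h)) * ‖coeff g k‖ ^ 2
      ≤ ∫ x, (g (x + (h : Torus)) - g x) ^ 2 ∂haarAddCircle := by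
    rw [← Finset.sum_congr rfl fun k _ => key g hg k]
    exact sum_sq_coeff_le (memLp_of_continuous (by fun_prop)) _
  have h2 : ∫ x, (g (x + (h : Torus)) - g x) ^ 2 ∂haarAddCircle
      ≤ L ^ 2 * ∫ x, (u (x + (h : Torus)) - u x) ^ 2 ∂haarAddCircle := by
    rw [← integral_const_mul]
    refine integral_mono (integrable_of_continuous (by fun_prop))
      (integrable_of_continuous (by fun_prop)) fun x => ?_
    have := pow_le_pow_left₀ (abs_nonneg _) (hL (x + (h : Torus)) x) 2
    simpa only [mul_pow, sq_abs] using this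
  have h3 : ∫ x, (u (x + (h : Torus)) - u x) ^ 2 ∂haarAddCircle
      = ∑ k ∈ modes M, (2 - 2 * Real.cos (k * h)) * ‖coeff u k‖ ^ 2 := by
    rw [← Finset.sum_congr rfl fun k _ => key u huc k]
    refine (hasSum_sq_coeff (memLp_of_continuous (by fun_prop))).unique
      (hasSum_sum_of_ne_finset_zero fun k hk => ?_)
    rw [key u huc, hu.coeff_eq_zero hk]; simp
  have h4 : ∑ k ∈ modes M, (2 - 2 * Real.cos (k * h)) * ‖coeff u k‖ ^ 2
      ≤ h ^ 2 * ∑ k ∈ modes M, (k : ℝ) ^ 2 * ‖coeff u k‖ ^ 2 := by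
    rw [Finset.mul_sum]
    refine Finset.sum_le_sum fun k _ => ?_
    rw [← mul_assoc]
    refine mul_le_mul_of_nonneg_right ?_ (by positivity)
    nlinarith [Real.one_sub_sq_div_two_le_cos (x := k * h)]
  have h5 : h ^ 2 / 4 * ∑ k ∈ modes M, (k : ℝ) ^ 2 * ‖coeff g k‖ ^ 2
      ≤ ∑ k ∈ modes M, (2 - 2 * Real.cos (k * h)) * ‖coeff g k‖ ^ 2 := by
    rw [Finset.mul_sum]
    refine Finset.sum_le_sum fun k hk => ?_
    rw [← mul_assoc]
    refine mul_le_mul_of_nonneg_right ?_ (by positivity)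
    have hkM : |(k : ℝ)| ≤ M := by
      rw [Finset.mem_Icc] at hk
      rw [abs_le]
      exact ⟨by exact_mod_cast hk.1, by exact_mod_cast hk.2⟩
    have hkh : |(k : ℝ) * h| ≤ π := by
      rw [abs_mul, abs_of_pos hh0]
      calc |(k : ℝ)| * h ≤ M * h := by gcongr
        _ = 1 := mul_inv_cancel₀ hM0.ne'
        _ ≤ π := by linarith [Real.pi_gt_three]
    have hc := Real.cos_le_one_sub_mul_cos_sq hkh
    have hp : 1 / 16 ≤ 1 / π ^ 2 := by
      gcongr
      nlinarith [Real.pi_pos, Real.pi_le_four]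
    have : 1 / 16 * (k * h) ^ 2 ≤ 1 / π ^ 2 * ((k : ℝ) * h) ^ 2 := by gcongr
    have e : 2 / π ^ 2 * ((k : ℝ) * h) ^ 2 = 2 * (1 / π ^ 2 * ((k : ℝ) * h) ^ 2) := by ring
    rw [e] at hc
    nlinarith
  have h6 := (h5.trans h1).trans (h2.trans
    (mul_le_mul_of_nonneg_left (h3.le.trans h4) (sq_nonneg L)))
  have hh2 : 0 < h ^ 2 := by positivity
  refine le_of_mul_le_mul_left ?_ hh2
  linarith

end AllenCahnSplitting

end

/-! ### The reaction flow: uniqueness, explicit solution, consistency -/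

noncomputable section

namespace AllenCahnSplitting

open MeasureTheory Set

/-- The reaction term `y - y³`. -/
def react (y : ℝ) : ℝ := y - y ^ 3

@[fun_prop]
lemma continuous_react : Continuous react := by unfold react; fun_prop

lemma abs_react_sub_le {C a b : ℝ} (ha : |a| ≤ C) (hb : |b| ≤ C) :
    |react a - react b| ≤ (1 + 3 * C ^ 2) * |a - b| := by
  have e : react a - react b = (1 - (a ^ 2 + a * b + b ^ 2)) * (a - b) := by
    unfold react; ring
  rw [e, abs_mul]
  refine mul_le_mul_of_nonneg_right ?_ (abs_nonneg _)
  have ha2 : a ^ 2 ≤ C ^ 2 := sq_le_sq' (by linarith [(abs_le.1 ha).1]) (abs_le.1 ha).2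
  have hb2 : b ^ 2 ≤ C ^ 2 := sq_le_sq' (by linarith [(abs_le.1 hb).1]) (abs_le.1 hb).2
  rw [abs_le]
  constructor <;> nlinarith [sq_nonneg (a + b), sq_nonneg (a - b)]

lemma abs_react_le {C a : ℝ} (ha : |a| ≤ C) : |react a| ≤ (1 + C ^ 2) * C := by
  have e : react a = (1 - a ^ 2) * a := by unfold react; ring
  have ha2 : a ^ 2 ≤ C ^ 2 := sq_le_sq' (by linarith [(abs_le.1 ha).1]) (abs_le.1 ha).2
  rw [e, abs_mul]
  refine mul_le_mul ?_ ha (abs_nonneg _) (by positivity)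
  rw [abs_le]
  constructor <;> nlinarith [sq_nonneg a]

/-- Two solutions on a compact interval stay in a common bounded set, where the cubic is Lipschitz.
The ODE uniqueness theorem is one-sided, so the two signs of `t` are separate. -/
lemma react_solution_unique {t : ℝ} {φ ψ : ℝ → ℝ}
    (hφ : ∀ s ∈ uIcc 0 t, HasDerivWithinAt φ (react (φ s)) (uIcc 0 t) s)
    (hψ : ∀ s ∈ uIcc 0 t, HasDerivWithinAt ψ (react (ψ s)) (uIcc 0 t) s)
    (h0 : φ 0 = ψ 0) : φ t = ψ t := by
  have hφc : ContinuousOn φ (uIcc 0 t) := fun s hs => (hφ s hs).continuousWithinAt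
  have hψc : ContinuousOn ψ (uIcc 0 t) := fun s hs => (hψ s hs).continuousWithinAt
  obtain ⟨C₁, hC₁⟩ := isCompact_uIcc.exists_bound_of_continuousOn hφc
  obtain ⟨C₂, hC₂⟩ := isCompact_uIcc.exists_bound_of_continuousOn hψc
  set C := max C₁ C₂
  have hlip : LipschitzOnWith (1 + 3 * C ^ 2).toNNReal react {y | |y| ≤ C} := by
    refine LipschitzOnWith.of_dist_le_mul fun x hx y hy => ?_
    rw [Real.coe_toNNReal _ (by positivity)]
    exact abs_react_sub_le hx hy
  have mφ : ∀ s ∈ uIcc 0 t, φ s ∈ {y | |y| ≤ C} := fun s hs =>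
    (hC₁ s hs).trans (le_max_left _ _)
  have mψ : ∀ s ∈ uIcc 0 t, ψ s ∈ {y | |y| ≤ C} := fun s hs =>
    (hC₂ s hs).trans (le_max_right _ _)
  rcases le_total 0 t with ht | ht
  · rw [uIcc_of_le ht] at *
    have hd : ∀ χ : ℝ → ℝ, (∀ s ∈ Icc 0 t, HasDerivWithinAt χ (react (χ s)) (Icc 0 t) s) →
        ∀ s ∈ Ico 0 t, HasDerivWithinAt χ (react (χ s)) (Ici s) s := fun χ hχ s hs =>
      (hχ s (Ico_subset_Icc_self hs)).mono_of_mem_nhdsWithin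
        (Filter.mem_of_superset (Icc_mem_nhdsGE hs.2) (Icc_subset_Icc_left hs.1))
    exact ODE_solution_unique_of_mem_Icc_right (v := fun _ => react)
      (s := fun _ => {y | |y| ≤ C}) (fun _ _ => hlip) hφc (hd φ hφ)
      (fun s hs => mφ s (Ico_subset_Icc_self hs)) hψc (hd ψ hψ)
      (fun s hs => mψ s (Ico_subset_Icc_self hs)) h0 ⟨ht, le_rfl⟩
  · rw [uIcc_of_ge ht] at *
    have hd : ∀ χ : ℝ → ℝ, (∀ s ∈ Icc t 0, HasDerivWithinAt χ (react (χ s)) (Icc t 0) s) →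
        ∀ s ∈ Ioc t 0, HasDerivWithinAt χ (react (χ s)) (Iic s) s := fun χ hχ s hs =>
      (hχ s (Ioc_subset_Icc_self hs)).mono_of_mem_nhdsWithin
        (Filter.mem_of_superset (Icc_mem_nhdsLE hs.1) (Icc_subset_Icc_right hs.2))
    exact ODE_solution_unique_of_mem_Icc_left (v := fun _ => react)
      (s := fun _ => {y | |y| ≤ C}) (fun _ _ => hlip) hφc (hd φ hφ)
      (fun s hs => mφ s (Ioc_subset_Icc_self hs)) hψc (hd ψ hψ)
      (fun s hs => mψ s (Ioc_subset_Icc_self hs)) h0 ⟨le_rfl, ht⟩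

lemma IsSN.unique {t : ℝ} {b w w' : Torus → ℝ} (h : IsSN t b w) (h' : IsSN t b w') :
    w = w' := by
  ext x
  obtain ⟨φ, h0, h1, hd⟩ := h x
  obtain ⟨ψ, h0', h1', hd'⟩ := h' x
  rw [← h1, ← h1']
  exact react_solution_unique hd hd' (h0.trans h0'.symm)

/-- The denominator `1 + b² (e^{2t} - 1)` in the explicit solution. -/
def flowDenom (t b : ℝ) : ℝ := 1 + b ^ 2 * (Real.exp (2 * t) - 1)

/-- The solution `b e^t / √(1 + b² (e^{2t} - 1))` of `φ' = φ - φ³`, `φ(0) = b`. -/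
def flow (t b : ℝ) : ℝ := b * Real.exp t / √(flowDenom t b)

lemma flow_zero (b : ℝ) : flow 0 b = b := by simp [flow, flowDenom]

lemma hasDerivAt_flow {t b : ℝ} (h : 0 < flowDenom t b) :
    HasDerivAt (fun s => flow s b) (react (flow t b)) t := by
  have h1 : HasDerivAt (fun s => flowDenom s b) (b ^ 2 * (Real.exp (2 * t) * 2)) t := by
    have := ((((hasDerivAt_id t).const_mul 2).exp.sub_const 1).const_mul (b ^ 2)).const_add 1
    simpa [flowDenom] using this
  have h2 := (((Real.hasDerivAt_exp t).const_mul b).div (h1.sqrt h.ne')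
    (Real.sqrt_pos.2 h).ne')
  refine h2.congr_deriv ?_
  unfold react flow
  have hs := Real.sqrt_pos.2 h
  have hsq := Real.sq_sqrt h.le
  set D := √(flowDenom t b)
  have he : Real.exp (2 * t) = Real.exp t ^ 2 := by rw [← Real.exp_nat_mul]; norm_num
  rw [he]
  field_simp

/-- The times for which the reaction flow of data bounded by `B` is controlled. -/
def reactTime (B : ℝ) : ℝ := 1 / (4 * (B ^ 2 + 1))

lemma reactTime_pos (B : ℝ) : 0 < reactTime B := by unfold reactTime; positivity

/-- This rules out blow-up in backward time: `e^{2t} - 1 ≥ -2|t|`, and `reactTime` is chosen so that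
`2 B² |t| ≤ 1/2`. -/
lemma half_le_flowDenom {B b t : ℝ} (hb : |b| ≤ B) (ht : |t| ≤ reactTime B) :
    1 / 2 ≤ flowDenom t b := by
  have hb2 : b ^ 2 ≤ B ^ 2 := sq_le_sq' (by linarith [(abs_le.1 hb).1]) (abs_le.1 hb).2
  have h1 : -(2 * |t|) ≤ Real.exp (2 * t) - 1 := by
    have := Real.add_one_le_exp (2 * t)
    linarith [neg_abs_le t]
  have h2 : |t| * (4 * (B ^ 2 + 1)) ≤ 1 := by
    rwa [reactTime, le_div_iff₀ (by positivity)] at ht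
  unfold flowDenom
  nlinarith [abs_nonneg t, mul_le_mul_of_nonneg_right hb2 (abs_nonneg t), sq_nonneg b,
    mul_le_mul_of_nonneg_left h1 (sq_nonneg b)]

lemma abs_flow_le {B b t : ℝ} (hb : |b| ≤ B) (ht : |t| ≤ reactTime B) :
    |flow t b| ≤ 2 * B := by
  have hB : 0 ≤ B := (abs_nonneg b).trans hb
  have hD := half_le_flowDenom hb ht
  have h4 : |t| ≤ 1 / 4 := by
    refine ht.trans ?_
    unfold reactTime
    gcongr
    nlinarith [sq_nonneg B]
  have he : Real.exp t ^ 2 ≤ 2 := by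
    rw [← Real.exp_nat_mul]
    have : ((2 : ℕ) : ℝ) * t ≤ Real.log 2 := by
      have := Real.log_two_gt_d9
      push_cast
      linarith [le_abs_self t]
    calc Real.exp ((2 : ℕ) * t) ≤ Real.exp (Real.log 2) := Real.exp_le_exp.2 this
      _ = 2 := Real.exp_log (by norm_num)
  have hb2 : b ^ 2 ≤ B ^ 2 := sq_le_sq' (by linarith [(abs_le.1 hb).1]) (abs_le.1 hb).2
  refine abs_le_of_sq_le_sq ?_ (by positivity)
  rw [flow, div_pow, Real.sq_sqrt (by linarith), mul_pow, div_le_iff₀ (by linarith)]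
  have := mul_le_mul hb2 he (by positivity) (by positivity)
  nlinarith [sq_nonneg B, mul_le_mul_of_nonneg_left hD (sq_nonneg B)]

lemma abs_le_reactTime_of_mem {B s t : ℝ} (ht : |t| ≤ reactTime B) (hs : s ∈ uIcc 0 t) :
    |s| ≤ reactTime B := by
  refine le_trans ?_ ht
  have := abs_sub_left_of_mem_uIcc hs
  simpa using this

lemma isSN_flow {B t : ℝ} {b : Torus → ℝ} (hb : ∀ x, |b x| ≤ B) (ht : |t| ≤ reactTime B) :
    IsSN t b (fun x => flow t (b x)) := by
  intro x
  refine ⟨fun s => flow s (b x), flow_zero _, rfl, fun s hs => ?_⟩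
  refine (hasDerivAt_flow ?_).hasDerivWithinAt
  linarith [half_le_flowDenom (hb x) (abs_le_reactTime_of_mem ht hs)]

lemma continuous_flow_comp {B t : ℝ} {b : Torus → ℝ} (hbc : Continuous b)
    (hb : ∀ x, |b x| ≤ B) (ht : |t| ≤ reactTime B) : Continuous fun x => flow t (b x) := by
  unfold flow
  refine Continuous.div (by fun_prop) ?_ fun x => ?_
  · unfold flowDenom; fun_prop
  · exact (Real.sqrt_pos.2 (by linarith [half_le_flowDenom (hb x) ht])).ne'

/-- The constant in the second order consistency estimate for the reaction flow. -/
def reactConst (B : ℝ) : ℝ := (1 + 3 * (2 * B) ^ 2) * ((1 + (2 * B) ^ 2) * (2 * B))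

/-- The mean value inequality is used twice: once for the displacement of the flow, then for the
remainder, whose derivative is `react (flow s b) - react b`. -/
lemma abs_flow_sub_le {B b t : ℝ} (hb : |b| ≤ B) (ht : |t| ≤ reactTime B) :
    |flow t b - b - t * react b| ≤ reactConst B * t ^ 2 := by
  have hB : 0 ≤ B := (abs_nonneg b).trans hb
  have hd : ∀ s ∈ uIcc 0 t, HasDerivWithinAt (fun s => flow s b) (react (flow s b)) (uIcc 0 t) s :=
    fun s hs => (hasDerivAt_flow (by
      linarith [half_le_flowDenom hb (abs_le_reactTime_of_mem ht hs)])).hasDerivWithinAt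
  have h1 : ∀ s ∈ uIcc 0 t, |flow s b - b| ≤ (1 + (2 * B) ^ 2) * (2 * B) * |t| := by
    intro s hs
    have := (convex_uIcc 0 t).norm_image_sub_le_of_norm_hasDerivWithin_le hd
      (fun s hs => abs_react_le (abs_flow_le hb (abs_le_reactTime_of_mem ht hs)))
      left_mem_uIcc hs
    rw [flow_zero, Real.norm_eq_abs, Real.norm_eq_abs, sub_zero] at this
    refine this.trans ?_
    have h3 := abs_sub_left_of_mem_uIcc hs
    simp only [sub_zero] at h3
    gcongr
  have h2 : ∀ s ∈ uIcc 0 t, HasDerivWithinAt (fun s => flow s b - s * react b)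
      (react (flow s b) - react b) (uIcc 0 t) s := fun s hs => by
    have h := (hd s hs).sub ((hasDerivWithinAt_id s _).mul_const (react b))
    rwa [one_mul] at h
  have := (convex_uIcc 0 t).norm_image_sub_le_of_norm_hasDerivWithin_le h2
    (C := reactConst B * |t|) (fun s hs => by
      have hb' : |b| ≤ 2 * B := by linarith
      refine (abs_react_sub_le (abs_flow_le hb (abs_le_reactTime_of_mem ht hs)) hb').trans ?_
      rw [reactConst, mul_assoc (1 + 3 * (2 * B) ^ 2)]
      exact mul_le_mul_of_nonneg_left (h1 s hs) (by positivity))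
    left_mem_uIcc right_mem_uIcc
  rw [flow_zero] at this
  simp only [zero_mul, sub_zero, Real.norm_eq_abs] at this
  calc |flow t b - b - t * react b| = |flow t b - t * react b - b| := by congr 1; ring
    _ ≤ reactConst B * |t| * |t| := this
    _ = reactConst B * t ^ 2 := by rw [mul_assoc, abs_mul_abs_self, sq]

end AllenCahnSplitting

end

/-! ### Low-mode norms, Sobolev embedding and heat multipliers -/

noncomputable section

namespace AllenCahnSplitting

open MeasureTheory Set AddCircle ComplexConjugate

/-- The squared `ℓ²` norm over the low modes. -/
def lowSq (M : ℕ) (c : ℤ → ℂ) : ℝ := ∑ k ∈ modes M, ‖c k‖ ^ 2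

/-- The squared `H¹` norm over the low modes. -/
def lowSob (M : ℕ) (c : ℤ → ℂ) : ℝ := ∑ k ∈ modes M, (1 + (k : ℝ) ^ 2) * ‖c k‖ ^ 2

lemma lowSq_nonneg (M : ℕ) (c : ℤ → ℂ) : 0 ≤ lowSq M c :=
  Finset.sum_nonneg fun _ _ => by positivity

lemma lowSob_nonneg (M : ℕ) (c : ℤ → ℂ) : 0 ≤ lowSob M c :=
  Finset.sum_nonneg fun _ _ => by positivity

lemma lowSob_eq (M : ℕ) (c : ℤ → ℂ) :
    lowSob M c = lowSq M c + ∑ k ∈ modes M, (k : ℝ) ^ 2 * ‖c k‖ ^ 2 := by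
  rw [lowSob, lowSq, ← Finset.sum_add_distrib]
  exact Finset.sum_congr rfl fun k _ => by ring

lemma lowSq_le_lowSob (M : ℕ) (c : ℤ → ℂ) : lowSq M c ≤ lowSob M c := by
  rw [lowSob_eq]
  exact le_add_of_nonneg_right (Finset.sum_nonneg fun _ _ => by positivity)

lemma sum_sq_mul_le_lowSob (M : ℕ) (c : ℤ → ℂ) :
    ∑ k ∈ modes M, (k : ℝ) ^ 2 * ‖c k‖ ^ 2 ≤ lowSob M c := by
  rw [lowSob_eq]
  exact le_add_of_nonneg_left (lowSq_nonneg M c)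

/-- The constant `∑ (1 + k²)⁻¹` of the Sobolev embedding. -/
def sobConst : ℝ := ∑' k : ℤ, (1 + (k : ℝ) ^ 2)⁻¹

lemma summable_sobConst : Summable fun k : ℤ => (1 + (k : ℝ) ^ 2)⁻¹ := by
  refine Summable.of_norm_bounded_eventually
    (Real.summable_one_div_int_pow (p := 2).2 (by norm_num)) ?_
  filter_upwards [(Set.finite_singleton (0 : ℤ)).compl_mem_cofinite] with k hk
  have hk : (k : ℝ) ≠ 0 := by exact_mod_cast hk
  rw [Real.norm_of_nonneg (by positivity), one_div]
  gcongr
  linarith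

lemma sobConst_nonneg : 0 ≤ sobConst := tsum_nonneg fun _ => by positivity

/-- Cauchy–Schwarz with weights `1 + k²`; the bound is independent of `M`. -/
lemma sum_norm_le_sqrt_lowSob (M : ℕ) (c : ℤ → ℂ) :
    ∑ k ∈ modes M, ‖c k‖ ≤ √(sobConst * lowSob M c) := by
  refine Real.le_sqrt_of_sq_le ?_
  have h := Finset.sum_mul_sq_le_sq_mul_sq (modes M)
    (fun k => (√(1 + (k : ℝ) ^ 2))⁻¹) (fun k => √(1 + (k : ℝ) ^ 2) * ‖c k‖)
  have e1 : ∑ k ∈ modes M, (√(1 + (k : ℝ) ^ 2))⁻¹ * (√(1 + (k : ℝ) ^ 2) * ‖c k‖)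
      = ∑ k ∈ modes M, ‖c k‖ := Finset.sum_congr rfl fun k _ => by
    have : √(1 + (k : ℝ) ^ 2) ≠ 0 := (Real.sqrt_pos.2 (by positivity)).ne'
    field_simp
  have e2 : ∑ k ∈ modes M, (√(1 + (k : ℝ) ^ 2) * ‖c k‖) ^ 2 = lowSob M c :=
    Finset.sum_congr rfl fun k _ => by rw [mul_pow, Real.sq_sqrt (by positivity)]
  have e3 : ∑ k ∈ modes M, ((√(1 + (k : ℝ) ^ 2))⁻¹) ^ 2 ≤ sobConst := by
    refine le_trans (le_of_eq (Finset.sum_congr rfl fun k _ => ?_))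
      (summable_sobConst.sum_le_tsum (modes M) fun _ _ => by positivity)
    rw [inv_pow, Real.sq_sqrt (by positivity)]
  rw [e1, e2] at h
  exact h.trans (mul_le_mul_of_nonneg_right e3 (lowSob_nonneg M c))

lemma card_modes_le {M : ℕ} (hM : 1 ≤ M) : ((modes M).card : ℝ) ≤ 3 * (M : ℝ) ^ 2 := by
  have h1 : (1 : ℝ) ≤ M := by exact_mod_cast hM
  have h2 : (modes M).card = 2 * M + 1 := by
    simp only [modes, Int.card_Icc]; omega
  rw [h2]
  push_cast
  nlinarith

/-- Cauchy–Schwarz over at most `3M²` modes: the factor `M²` is absorbed by `τ M² ≤ l₀`. Thus an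
`L²` deviation of size `√τ` still gives a sup bound uniform in `M`. -/
lemma sum_norm_le_sqrt_lowSq {M : ℕ} (hM : 1 ≤ M) {l₀ τ C : ℝ} (hτ : τ * (M : ℝ) ^ 2 ≤ l₀)
    (hC : 0 ≤ C) {c : ℤ → ℂ} (hc : lowSq M c ≤ C * τ) :
    ∑ k ∈ modes M, ‖c k‖ ≤ √(3 * l₀ * C) := by
  refine Real.le_sqrt_of_sq_le ?_
  calc (∑ k ∈ modes M, ‖c k‖) ^ 2 ≤ (modes M).card * lowSq M c := sq_sum_le_card_mul_sum_sq
    _ ≤ 3 * (M : ℝ) ^ 2 * (C * τ) := mul_le_mul (card_modes_le hM) hc (lowSq_nonneg _ _)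
        (by positivity)
    _ = 3 * (τ * (M : ℝ) ^ 2) * C := by ring
    _ ≤ 3 * l₀ * C := by gcongr

/-- The heat multiplier `e^{-ν t k²}`. -/
def heat (ν t : ℝ) (k : ℤ) : ℝ := Real.exp (-(ν * t * (k : ℝ) ^ 2))

lemma SL_apply (ν t : ℝ) (c : ℤ → ℂ) (k : ℤ) : SL ν t c k = heat ν t k * c k := rfl

lemma heat_pos (ν t : ℝ) (k : ℤ) : 0 < heat ν t k := Real.exp_pos _

lemma heat_zero (ν : ℝ) (k : ℤ) : heat ν 0 k = 1 := by simp [heat]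

lemma heat_add (ν s t : ℝ) (k : ℤ) : heat ν (s + t) k = heat ν s k * heat ν t k := by
  rw [heat, heat, heat, ← Real.exp_add]; congr 1; ring

lemma sq_le_of_mem_modes {M : ℕ} {k : ℤ} (hk : k ∈ modes M) : (k : ℝ) ^ 2 ≤ (M : ℝ) ^ 2 := by
  rw [Finset.mem_Icc] at hk
  have h1 : -(M : ℝ) ≤ k := by exact_mod_cast hk.1
  have h2 : (k : ℝ) ≤ M := by exact_mod_cast hk.2
  exact sq_le_sq' h1 h2

section multipliers

variable {ν l₀ τ θ : ℝ} {M : ℕ} {k : ℤ}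

lemma freq_le (hν : 0 < ν) (hτ0 : 0 < τ) (hτ : τ * (M : ℝ) ^ 2 ≤ l₀) (hk : k ∈ modes M) :
    ν * τ * (k : ℝ) ^ 2 ≤ ν * l₀ := by
  rw [mul_assoc]
  have := sq_le_of_mem_modes hk
  gcongr
  exact le_trans (by gcongr) hτ

lemma abs_exponent_le (hν : 0 < ν) (hτ0 : 0 < τ) (hθ : |θ| ≤ 2) :
    |-(ν * (θ * τ) * (k : ℝ) ^ 2)| ≤ 2 * (ν * τ * (k : ℝ) ^ 2) := by
  have e : -(ν * (θ * τ) * (k : ℝ) ^ 2) = -θ * (ν * τ * (k : ℝ) ^ 2) := by ring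
  have h : 0 ≤ ν * τ * (k : ℝ) ^ 2 := by positivity
  rw [e, abs_mul, abs_of_nonneg h, abs_neg]
  gcongr

lemma heat_le (hν : 0 < ν) (hτ0 : 0 < τ) (hτ : τ * (M : ℝ) ^ 2 ≤ l₀) (hk : k ∈ modes M)
    (hθ : |θ| ≤ 2) : heat ν (θ * τ) k ≤ Real.exp (2 * (ν * l₀)) := by
  refine Real.exp_le_exp.2 ((le_abs_self _).trans ((abs_exponent_le hν hτ0 hθ).trans ?_))
  gcongr 2 * ?_
  exact freq_le hν hτ0 hτ hk

lemma abs_exp_sub_one_le_mul (z : ℝ) : |Real.exp z - 1| ≤ |z| * Real.exp |z| := by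
  have h1 := Real.add_one_le_exp z
  have h2 := Real.add_one_le_exp (-z)
  have h3 : Real.exp z * Real.exp (-z) = 1 := by rw [← Real.exp_add]; simp
  have h4 := Real.exp_pos z
  have h5 : 1 ≤ Real.exp |z| := Real.one_le_exp (abs_nonneg z)
  have h6 : Real.exp z ≤ Real.exp |z| := Real.exp_le_exp.2 (le_abs_self z)
  have h7 : Real.exp z - 1 ≤ z * Real.exp z := by nlinarith
  rw [abs_le]
  constructor
  · nlinarith [neg_abs_le z, abs_nonneg z]
  · nlinarith [le_abs_self z, abs_nonneg z]

/-- The constant in the estimate of `heat - 1`. -/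
def heatConst (ν l₀ : ℝ) : ℝ := 4 * ν * (ν * l₀) * Real.exp (2 * (ν * l₀)) ^ 2

/-- Of the two factors `ντk²` in the square, one is traded for `νl₀`. The remaining `k²` is what an
`H¹` function can pay for, at the price of only one power of `τ`. -/
lemma heat_sub_one_sq_le (hν : 0 < ν) (hτ0 : 0 < τ) (hτ : τ * (M : ℝ) ^ 2 ≤ l₀)
    (hk : k ∈ modes M) (hθ : |θ| ≤ 2) :
    (heat ν (θ * τ) k - 1) ^ 2 ≤ heatConst ν l₀ * τ * (k : ℝ) ^ 2 := by
  have hx := freq_le hν hτ0 hτ hk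
  have hz := abs_exponent_le (k := k) hν hτ0 hθ
  have h := abs_exp_sub_one_le_mul (-(ν * (θ * τ) * (k : ℝ) ^ 2))
  have hx0 : 0 ≤ ν * τ * (k : ℝ) ^ 2 := by positivity
  have h1 : |heat ν (θ * τ) k - 1|
      ≤ 2 * (ν * τ * (k : ℝ) ^ 2) * Real.exp (2 * (ν * l₀)) := by
    refine h.trans (mul_le_mul hz (Real.exp_le_exp.2 (hz.trans ?_)) (Real.exp_pos _).le
      (by positivity))
    linarith
  rw [← sq_abs]
  refine (pow_le_pow_left₀ (abs_nonneg _) h1 2).trans ?_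
  have e : (2 * (ν * τ * (k : ℝ) ^ 2) * Real.exp (2 * (ν * l₀))) ^ 2
      = 4 * Real.exp (2 * (ν * l₀)) ^ 2 * ((ν * τ * (k : ℝ) ^ 2) * (ν * τ * (k : ℝ) ^ 2)) := by
    ring
  rw [e, heatConst]
  calc _ ≤ 4 * Real.exp (2 * (ν * l₀)) ^ 2 * ((ν * τ * (k : ℝ) ^ 2) * (ν * l₀)) := by gcongr
    _ = _ := by ring

end multipliers

lemma norm_add_sq_le (a b : ℂ) : ‖a + b‖ ^ 2 ≤ 2 * (‖a‖ ^ 2 + ‖b‖ ^ 2) := by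
  have h := pow_le_pow_left₀ (norm_nonneg _) (norm_add_le a b) 2
  nlinarith [sq_nonneg (‖a‖ - ‖b‖)]

lemma norm_add₃_sq_le (a b c : ℂ) : ‖a + b + c‖ ^ 2 ≤ 3 * (‖a‖ ^ 2 + ‖b‖ ^ 2 + ‖c‖ ^ 2) := by
  have h := pow_le_pow_left₀ (norm_nonneg _) (norm_add₃_le (a := a) (b := b) (c := c)) 2
  nlinarith [sq_nonneg (‖a‖ - ‖b‖), sq_nonneg (‖a‖ - ‖c‖), sq_nonneg (‖b‖ - ‖c‖)]

lemma norm_add₄_sq_le (a b c d : ℂ) :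
    ‖a + b + c + d‖ ^ 2 ≤ 4 * (‖a‖ ^ 2 + ‖b‖ ^ 2 + ‖c‖ ^ 2 + ‖d‖ ^ 2) := by
  have h := norm_add_sq_le (a + b) (c + d)
  have h1 := norm_add_sq_le a b
  have h2 := norm_add_sq_le c d
  rw [← add_assoc] at h
  linarith

lemma IsTrig.lowSq_sub_eq {M : ℕ} {u b : Torus → ℝ} (hu : IsTrig M u) (hb : IsTrig M b) :
    ∫ x, (b x - u x) ^ 2 ∂haarAddCircle = lowSq M fun k => coeff b k - coeff u k := by
  have huc := hu.continuous
  have hbc := hb.continuous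
  have e : ∀ k, coeff (fun x => b x - u x) k = coeff b k - coeff u k := coeff_sub hbc huc
  have h := hasSum_sq_coeff (f := fun x => b x - u x) (memLp_of_continuous (by fun_prop))
  simp_rw [e] at h
  refine h.unique (hasSum_sum_of_ne_finset_zero fun k hk => ?_)
  simp [hu.coeff_eq_zero hk, hb.coeff_eq_zero hk]

/-- The bound on the low `H¹` norm of `u - u³`. -/
def reactSob (R : ℝ) : ℝ := 4 * (1 + 3 * √(sobConst * R) ^ 2) ^ 2 * R

lemma IsTrig.abs_le_of_lowSob {M : ℕ} {u : Torus → ℝ} (hu : IsTrig M u) {R : ℝ}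
    (hR : lowSob M (coeff u) ≤ R) (x : Torus) : |u x| ≤ √(sobConst * R) := by
  refine (hu.abs_apply_le x).trans ((sum_norm_le_sqrt_lowSob _ _).trans (Real.sqrt_le_sqrt ?_))
  exact mul_le_mul_of_nonneg_left hR sobConst_nonneg

/-- On the range of `u` the cubic is Lipschitz and vanishes at `0`; the gradient part comes from the
comparison of increments. -/
lemma IsTrig.lowSob_react_le {M : ℕ} (hM : 1 ≤ M) {u : Torus → ℝ} (hu : IsTrig M u) {R : ℝ}
    (hR : lowSob M (coeff u) ≤ R) :
    lowSob M (coeff fun x => react (u x)) ≤ reactSob R := by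
  have huc := hu.continuous
  set B := √(sobConst * R)
  have hB := hu.abs_le_of_lowSob hR
  have h1 := hu.sum_sq_mul_coeff_le hM (g := fun x => react (u x)) (by fun_prop)
    (fun x y => abs_react_sub_le (hB x) (hB y))
  have h2 : lowSq M (coeff fun x => react (u x)) ≤ (1 + 3 * B ^ 2) ^ 2 * lowSq M (coeff u) := by
    refine (sum_sq_coeff_le (memLp_of_continuous (by fun_prop)) _).trans ?_
    rw [lowSq, ← hu.integral_sq, ← integral_const_mul]
    refine integral_mono (integrable_of_continuous (by fun_prop))
      (integrable_of_continuous (by fun_prop)) fun x => ?_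
    have h := abs_react_sub_le (hB x) (b := 0) (by simp)
    have h0 : react 0 = 0 := by simp [react]
    rw [h0, sub_zero, sub_zero] at h
    have := pow_le_pow_left₀ (abs_nonneg _) h 2
    simpa only [mul_pow, sq_abs] using this
  have hq := mul_nonneg (sq_nonneg (1 + 3 * B ^ 2)) (lowSq_nonneg M (coeff u))
  rw [lowSob_eq, reactSob]
  calc _ ≤ 4 * (1 + 3 * B ^ 2) ^ 2 * lowSob M (coeff u) := by
        rw [lowSob_eq]; linarith
    _ ≤ _ := by gcongr

end AllenCahnSplitting

end

/-! ### Consistency of a Strang substep with exponential Euler -/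

noncomputable section

namespace AllenCahnSplitting

open MeasureTheory Set AddCircle ComplexConjugate

/-- First order consistency of the reaction substep, tested against a reference function `u`. -/
lemma lowSq_reaction_residual_le {M : ℕ} {u b : Torus → ℝ} (hu : IsTrig M u) (hb : IsTrig M b)
    {B t : ℝ} (huB : ∀ x, |u x| ≤ B) (hbB : ∀ x, |b x| ≤ B) (ht : |t| ≤ reactTime B) :
    lowSq M (fun k => coeff (fun x => flow t (b x)) k - coeff b k
        - t * coeff (fun x => react (u x)) k)
      ≤ 2 * t ^ 2 * (reactConst B ^ 2 * t ^ 2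
        + (1 + 3 * B ^ 2) ^ 2 * lowSq M fun k => coeff b k - coeff u k) := by
  have huc := hu.continuous
  have hbc := hb.continuous
  have hwc := continuous_flow_comp hbc hbB ht
  have e : ∀ k, coeff (fun x => flow t (b x)) k - coeff b k - t * coeff (fun x => react (u x)) k
      = coeff (fun x => flow t (b x) - b x - t * react (u x)) k := fun k => by
    rw [coeff_sub (by fun_prop) (by fun_prop), coeff_sub hwc hbc, coeff_const_mul]
  simp_rw [e]
  refine (sum_sq_coeff_le (memLp_of_continuous (by fun_prop)) _).trans ?_
  rw [← hu.lowSq_sub_eq hb]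
  have hpt : ∀ x, (flow t (b x) - b x - t * react (u x)) ^ 2
      ≤ 2 * t ^ 2 * (reactConst B ^ 2 * t ^ 2)
        + 2 * t ^ 2 * ((1 + 3 * B ^ 2) ^ 2 * (b x - u x) ^ 2) := fun x => by
    have h1 := pow_le_pow_left₀ (abs_nonneg _) (abs_flow_sub_le (hbB x) ht) 2
    have h2 := pow_le_pow_left₀ (abs_nonneg _) (abs_react_sub_le (hbB x) (huB x)) 2
    rw [sq_abs] at h1
    rw [mul_pow, sq_abs, sq_abs] at h2
    have h3 := mul_le_mul_of_nonneg_left h2 (sq_nonneg t)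
    have e : flow t (b x) - b x - t * react (u x)
        = (flow t (b x) - b x - t * react (b x)) + t * (react (b x) - react (u x)) := by ring
    rw [e]
    refine add_sq_le.trans ?_
    rw [mul_pow t]
    linarith
  refine (integral_mono (integrable_of_continuous (by fun_prop))
    (integrable_of_continuous (by fun_prop)) hpt).trans (le_of_eq ?_)
  rw [integral_add (integrable_of_continuous (by fun_prop))
    (integrable_of_continuous (by fun_prop)), integral_const, integral_const_mul,
    integral_const_mul]
  simp only [probReal_univ, one_smul]
  ring

/-- `v` agrees with the time `θ τ` exponential Euler approximation started from the trigonometric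
polynomial `u`, up to a residual of size `O(τ^{3/2})` in `L²`. -/
structure Approx (ν : ℝ) (M : ℕ) (τ : ℝ) (u : Torus → ℝ) (θ K : ℝ) (v : Torus → ℝ) : Prop where
  isTrig : IsTrig M v
  residual : ∃ r : ℤ → ℂ, lowSq M r ≤ K * τ ∧ ∀ k ∈ modes M,
    coeff v k = heat ν (θ * τ) k * coeff u k + (θ * τ : ℝ) * coeff (fun x => react (u x)) k
      + τ * r k

lemma Approx.refl {ν : ℝ} {M : ℕ} {τ : ℝ} {u : Torus → ℝ} (hu : IsTrig M u) :
    Approx ν M τ u 0 0 u :=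
  ⟨hu, 0, by simp [lowSq], fun k _ => by simp [heat_zero]⟩

lemma coeff_cutoff_SL {M : ℕ} {ν t : ℝ} (v : Torus → ℝ) {k : ℤ} (hk : k ∈ modes M) :
    coeff (cutoff M (SL ν t (coeff v))) k = heat ν t k * coeff v k := by
  rw [coeff_cutoff ((conjSymm_coeff v).SL ν t), if_pos hk, SL_apply]

lemma isTrig_cutoff_SL {M : ℕ} {ν t : ℝ} (v : Torus → ℝ) :
    IsTrig M (cutoff M (SL ν t (coeff v))) :=
  isTrig_cutoff ((conjSymm_coeff v).SL ν t)

lemma norm_ofReal_mul_sq (a : ℝ) (z : ℂ) : ‖(a : ℂ) * z‖ ^ 2 = a ^ 2 * ‖z‖ ^ 2 := by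
  rw [norm_mul, mul_pow, Complex.norm_real, Real.norm_eq_abs, sq_abs]

section step

variable {ν l₀ τ θ K R : ℝ} {M : ℕ} {u v : Torus → ℝ}

/-- The constant in the bound of the distance to the reference function. -/
def devConst (ν l₀ R K : ℝ) : ℝ := 3 * (heatConst ν l₀ * R + 4 * reactSob R + K)

lemma heatConst_nonneg (hν : 0 < ν) (hl₀ : 0 < l₀) : 0 ≤ heatConst ν l₀ := by
  unfold heatConst; positivity

lemma Approx.lowSq_sub_le (hν : 0 < ν) (hl₀ : 0 < l₀) (hM : 1 ≤ M) (hτ0 : 0 < τ) (hτ1 : τ ≤ 1)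
    (hτ : τ * (M : ℝ) ^ 2 ≤ l₀) (hu : IsTrig M u) (hR : lowSob M (coeff u) ≤ R)
    (hθ : |θ| ≤ 2) (hK : 0 ≤ K) (h : Approx ν M τ u θ K v) :
    lowSq M (fun k => coeff v k - coeff u k) ≤ devConst ν l₀ R K * τ := by
  obtain ⟨r, hr, hv⟩ := h.residual
  set F := coeff fun x => react (u x)
  have hF : lowSq M F ≤ reactSob R := (lowSq_le_lowSob _ _).trans (hu.lowSob_react_le hM hR)
  have hA := heatConst_nonneg hν hl₀
  have hθ2 : θ ^ 2 ≤ 4 := by nlinarith [abs_le.1 hθ, sq_abs θ, abs_nonneg θ]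
  have hk : ∀ k ∈ modes M, ‖coeff v k - coeff u k‖ ^ 2
      ≤ 3 * (heatConst ν l₀ * τ * ((k : ℝ) ^ 2 * ‖coeff u k‖ ^ 2) + 4 * τ * ‖F k‖ ^ 2
        + τ * ‖r k‖ ^ 2) := fun k hk => by
    have e : coeff v k - coeff u k = ((heat ν (θ * τ) k - 1 : ℝ) : ℂ) * coeff u k
        + (θ * τ : ℝ) * F k + τ * r k := by
      rw [hv k hk]; push_cast; ring
    rw [e]
    refine (norm_add₃_sq_le _ _ _).trans ?_
    rw [norm_ofReal_mul_sq, norm_ofReal_mul_sq, norm_ofReal_mul_sq]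
    have h1 := mul_le_mul_of_nonneg_right (heat_sub_one_sq_le hν hτ0 hτ hk hθ)
      (sq_nonneg ‖coeff u k‖)
    have hτ2 : τ ^ 2 ≤ τ := by nlinarith
    have h2 : (θ * τ) ^ 2 * ‖F k‖ ^ 2 ≤ 4 * τ * ‖F k‖ ^ 2 := by
      rw [mul_pow]
      gcongr
    have h3 : τ ^ 2 * ‖r k‖ ^ 2 ≤ τ * ‖r k‖ ^ 2 := by gcongr
    linarith
  refine (Finset.sum_le_sum hk).trans ?_
  rw [← Finset.mul_sum, Finset.sum_add_distrib, Finset.sum_add_distrib, ← Finset.mul_sum,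
    ← Finset.mul_sum, ← Finset.mul_sum, devConst]
  have s1 := mul_le_mul_of_nonneg_left ((sum_sq_mul_le_lowSob M (coeff u)).trans hR)
    (mul_nonneg hA hτ0.le)
  have s2 := mul_le_mul_of_nonneg_left hF (mul_nonneg (by norm_num : (0 : ℝ) ≤ 4) hτ0.le)
  have s3 := mul_le_mul_of_nonneg_left hr hτ0.le
  have s4 : τ * (K * τ) ≤ K * τ := by nlinarith [mul_nonneg hK hτ0.le]
  unfold lowSq at s2 s3
  linarith

/-- The constant in the bound of the distance to the reference function after a half heat step. -/
def heatDevConst (ν l₀ R K : ℝ) : ℝ :=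
  2 * (Real.exp (2 * (ν * l₀)) ^ 2 * devConst ν l₀ R K + heatConst ν l₀ * R)

lemma lowSq_heat_sub_le (hν : 0 < ν) (hl₀ : 0 < l₀) (hτ0 : 0 < τ)
    (hτ : τ * (M : ℝ) ^ 2 ≤ l₀) (hR : lowSob M (coeff u) ≤ R)
    (hv : lowSq M (fun k => coeff v k - coeff u k) ≤ devConst ν l₀ R K * τ) (hθ : |θ| ≤ 2) :
    lowSq M (fun k => coeff (cutoff M (SL ν (θ * τ) (coeff v))) k - coeff u k)
      ≤ heatDevConst ν l₀ R K * τ := by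
  have hA := heatConst_nonneg hν hl₀
  have hk : ∀ k ∈ modes M, ‖coeff (cutoff M (SL ν (θ * τ) (coeff v))) k - coeff u k‖ ^ 2
      ≤ 2 * (Real.exp (2 * (ν * l₀)) ^ 2 * ‖coeff v k - coeff u k‖ ^ 2
        + heatConst ν l₀ * τ * ((k : ℝ) ^ 2 * ‖coeff u k‖ ^ 2)) := fun k hk => by
    have e : (heat ν (θ * τ) k : ℂ) * coeff v k - coeff u k
        = (heat ν (θ * τ) k : ℂ) * (coeff v k - coeff u k)
          + ((heat ν (θ * τ) k - 1 : ℝ) : ℂ) * coeff u k := by push_cast; ring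
    rw [coeff_cutoff_SL v hk, e]
    refine (norm_add_sq_le _ _).trans ?_
    rw [norm_ofReal_mul_sq, norm_ofReal_mul_sq]
    have h1 := mul_le_mul_of_nonneg_right (heat_sub_one_sq_le hν hτ0 hτ hk hθ)
      (sq_nonneg ‖coeff u k‖)
    have h2 : heat ν (θ * τ) k ^ 2 * ‖coeff v k - coeff u k‖ ^ 2
        ≤ Real.exp (2 * (ν * l₀)) ^ 2 * ‖coeff v k - coeff u k‖ ^ 2 := by
      have := heat_le hν hτ0 hτ hk hθ
      have := heat_pos ν (θ * τ) k
      gcongr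
    linarith
  refine (Finset.sum_le_sum hk).trans ?_
  rw [← Finset.mul_sum, Finset.sum_add_distrib, ← Finset.mul_sum, ← Finset.mul_sum, heatDevConst]
  have s1 := mul_le_mul_of_nonneg_left ((sum_sq_mul_le_lowSob M (coeff u)).trans hR)
    (mul_nonneg hA hτ0.le)
  have s2 := mul_le_mul_of_nonneg_left hv (sq_nonneg (Real.exp (2 * (ν * l₀))))
  unfold lowSq at s2
  linarith

/-- A bound for functions at distance `O(τ^{1/2})` of the reference function. -/
def supConst (l₀ R D : ℝ) : ℝ := √(sobConst * R) + √(3 * l₀ * D)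

lemma IsTrig.abs_le_supConst (hM : 1 ≤ M) (hτ : τ * (M : ℝ) ^ 2 ≤ l₀)
    (hR : lowSob M (coeff u) ≤ R) {b : Torus → ℝ} (hb : IsTrig M b) {D : ℝ} (hD : 0 ≤ D)
    (h : lowSq M (fun k => coeff b k - coeff u k) ≤ D * τ) (x : Torus) :
    |b x| ≤ supConst l₀ R D := by
  refine (hb.abs_apply_le x).trans ?_
  have h1 : ∑ k ∈ modes M, ‖coeff b k‖
      ≤ ∑ k ∈ modes M, ‖coeff u k‖ + ∑ k ∈ modes M, ‖coeff b k - coeff u k‖ := by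
    rw [← Finset.sum_add_distrib]
    refine Finset.sum_le_sum fun k _ => ?_
    simpa using norm_add_le (coeff u k) (coeff b k - coeff u k)
  refine h1.trans (add_le_add ((sum_norm_le_sqrt_lowSob _ _).trans (Real.sqrt_le_sqrt ?_))
    (sum_norm_le_sqrt_lowSq hM hτ hD h))
  exact mul_le_mul_of_nonneg_left hR sobConst_nonneg

end step

lemma IsS2.unique {ν : ℝ} {M : ℕ} {t : ℝ} {u v v' : Torus → ℝ} (h : IsS2 ν M t u v)
    (h' : IsS2 ν M t u v') : v = v' := by
  obtain ⟨w, hw, rfl⟩ := h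
  obtain ⟨w', hw', rfl⟩ := h'
  rw [hw.unique hw']

/-- Reaction is evaluated at a state within `O(√τ)` of `u` in `L²`, so replacing it there by `react
(u x)` costs `O(τ^{3/2})`. Replacing heat factors on `F` by `1` costs the same, because `F` is
bounded in `H¹`. All comparisons are with the initial `u`, so intermediate states need no `H¹`
bound. -/
lemma Approx.step {ν l₀ R θ K θ' : ℝ} (hν : 0 < ν) (hl₀ : 0 < l₀) (hR0 : 0 ≤ R) (hK : 0 ≤ K)
    (hθ : |θ| ≤ 2) (hθ' : |θ'| ≤ 2) :
    ∃ τ₀ K' : ℝ, 0 < τ₀ ∧ 0 ≤ K' ∧ ∀ (M : ℕ) (τ : ℝ) (u v : Torus → ℝ), 1 ≤ M → 0 < τ → τ ≤ τ₀ →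
      τ * (M : ℝ) ^ 2 ≤ l₀ → IsTrig M u → lowSob M (coeff u) ≤ R → Approx ν M τ u θ K v →
      ∃ v', IsS2 ν M (θ' * τ) v v' ∧ Approx ν M τ u (θ + θ') K' v' := by
  set D := heatDevConst ν l₀ R K with hD
  set B := supConst l₀ R D with hB
  set G := Real.exp (2 * (ν * l₀)) with hG
  set A := heatConst ν l₀ with hAdef
  have hA : 0 ≤ A := heatConst_nonneg hν hl₀
  have hRS : 0 ≤ reactSob R := by unfold reactSob; positivity
  have hD0 : 0 ≤ D := by
    rw [hD, heatDevConst, devConst]; positivity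
  set C := 8 * (reactConst B ^ 2 * 4 + (1 + 3 * B ^ 2) ^ 2 * D) with hC
  have hC0 : 0 ≤ C := by positivity
  -- Half of `reactTime B`, because `|θ'| ≤ 2`.
  refine ⟨min 1 (reactTime B / 2), 4 * (8 * A * reactSob R + G ^ 2 * K + G ^ 2 * C),
    lt_min one_pos (half_pos (reactTime_pos B)), by positivity, ?_⟩
  intro M τ u v hM hτ0 hτ₀ hτ hu hR hv
  have hτ1 : τ ≤ 1 := hτ₀.trans (min_le_left _ _)
  have hτB : 2 * τ ≤ reactTime B := by linarith [hτ₀.trans (min_le_right _ _)]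
  have ht : |θ' * τ| ≤ reactTime B := by
    rw [abs_mul, abs_of_pos hτ0]
    exact le_trans (by gcongr) hτB
  have hhalf : θ' * τ / 2 = θ' / 2 * τ := by ring
  have hθh : |θ' / 2| ≤ 2 := by
    rw [abs_div, abs_two]; linarith [abs_nonneg θ']
  set b := cutoff M (SL ν (θ' * τ / 2) (coeff v)) with hb
  have hbT : IsTrig M b := isTrig_cutoff_SL v
  have hbu : lowSq M (fun k => coeff b k - coeff u k) ≤ D * τ := by
    rw [hb, hhalf]
    exact lowSq_heat_sub_le hν hl₀ hτ0 hτ hR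
      (hv.lowSq_sub_le hν hl₀ hM hτ0 hτ1 hτ hu hR hθ hK) hθh
  have hbB : ∀ x, |b x| ≤ B := hbT.abs_le_supConst hM hτ hR hD0 hbu
  have huB : ∀ x, |u x| ≤ B := hu.abs_le_supConst hM hτ hR hD0 (by
    simp only [lowSq, sub_self, norm_zero]
    simpa using mul_nonneg hD0 hτ0.le)
  set w := fun x => flow (θ' * τ) (b x) with hw
  set F := coeff fun x => react (u x) with hF
  refine ⟨_, ⟨w, isSN_flow hbB ht, rfl⟩, isTrig_cutoff_SL w, ?_⟩
  obtain ⟨r, hr, hvr⟩ := hv.residual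
  set ρ : ℤ → ℂ := fun k => coeff w k - coeff b k - (θ' * τ : ℝ) * F k with hρ
  -- Here `t² = O(τ²)` multiplies a squared deviation `O(τ)`; dividing by `τ²` below leaves the
  -- required `O(τ)`.
  have hρC : lowSq M ρ ≤ C * τ ^ 3 := by
    have hθ2 : θ' ^ 2 ≤ 4 := by nlinarith [abs_le.1 hθ', sq_abs θ', abs_nonneg θ']
    have ht2 : (θ' * τ) ^ 2 ≤ 4 * τ ^ 2 := by rw [mul_pow]; gcongr
    have hτ2 : τ ^ 2 ≤ τ := by nlinarith
    refine (lowSq_reaction_residual_le hu hbT huB hbB ht).trans ?_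
    calc _ ≤ 2 * (4 * τ ^ 2) * (reactConst B ^ 2 * (4 * τ) + (1 + 3 * B ^ 2) ^ 2 * (D * τ)) := by
          have := lowSq_nonneg M fun k => coeff b k - coeff u k
          gcongr
          linarith
      _ = _ := by rw [hC]; ring
  set m := heat ν (θ' / 2 * τ) with hm
  have hmm : ∀ k, heat ν (θ' * τ) k = m k * m k := fun k => by
    rw [hm, ← heat_add]; congr 1; ring
  -- The four terms are: the full heat factor on the old reaction term, the old residual
  -- transported, the second half heat step on the new reaction term, and the reaction error.
  refine ⟨fun k => ((θ * (heat ν (θ' * τ) k - 1) : ℝ) : ℂ) * F k + (heat ν (θ' * τ) k : ℝ) * r k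
    + (θ' * (m k - 1) : ℝ) * F k + (m k / τ : ℝ) * ρ k, ?_, ?_⟩
  · have hk : ∀ k ∈ modes M, ‖((θ * (heat ν (θ' * τ) k - 1) : ℝ) : ℂ) * F k
        + (heat ν (θ' * τ) k : ℝ) * r k + (θ' * (m k - 1) : ℝ) * F k
        + (m k / τ : ℝ) * ρ k‖ ^ 2
        ≤ 4 * (8 * A * τ * ((k : ℝ) ^ 2 * ‖F k‖ ^ 2) + G ^ 2 * ‖r k‖ ^ 2
          + G ^ 2 / τ ^ 2 * ‖ρ k‖ ^ 2) := fun k hk => by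
      refine (norm_add₄_sq_le _ _ _ _).trans ?_
      rw [norm_ofReal_mul_sq, norm_ofReal_mul_sq, norm_ofReal_mul_sq, norm_ofReal_mul_sq]
      have hsq : ∀ a : ℝ, |a| ≤ 2 → a ^ 2 ≤ 4 := fun a ha => by
        nlinarith [sq_abs a, abs_nonneg a]
      have h1 : (θ * (heat ν (θ' * τ) k - 1)) ^ 2 ≤ 4 * (A * τ * (k : ℝ) ^ 2) := by
        rw [mul_pow]
        exact mul_le_mul (hsq θ hθ) (heat_sub_one_sq_le hν hτ0 hτ hk hθ') (sq_nonneg _)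
          (by norm_num)
      have h2 : heat ν (θ' * τ) k ^ 2 ≤ G ^ 2 :=
        pow_le_pow_left₀ (heat_pos _ _ _).le (heat_le hν hτ0 hτ hk hθ') 2
      have h3 : (θ' * (m k - 1)) ^ 2 ≤ 4 * (A * τ * (k : ℝ) ^ 2) := by
        rw [mul_pow]
        exact mul_le_mul (hsq θ' hθ') (heat_sub_one_sq_le hν hτ0 hτ hk hθh) (sq_nonneg _)
          (by norm_num)
      have h4 : (m k / τ) ^ 2 ≤ G ^ 2 / τ ^ 2 := by
        rw [div_pow]
        gcongr
        · exact (heat_pos _ _ _).le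
        · exact heat_le hν hτ0 hτ hk hθh
      have i1 := mul_le_mul_of_nonneg_right h1 (sq_nonneg ‖F k‖)
      have i2 := mul_le_mul_of_nonneg_right h2 (sq_nonneg ‖r k‖)
      have i3 := mul_le_mul_of_nonneg_right h3 (sq_nonneg ‖F k‖)
      have i4 := mul_le_mul_of_nonneg_right h4 (sq_nonneg ‖ρ k‖)
      linarith
    refine (Finset.sum_le_sum hk).trans ?_
    rw [← Finset.mul_sum, Finset.sum_add_distrib, Finset.sum_add_distrib, ← Finset.mul_sum,
      ← Finset.mul_sum, ← Finset.mul_sum]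
    have s1 := mul_le_mul_of_nonneg_left ((sum_sq_mul_le_lowSob M F).trans
      (hu.lowSob_react_le hM hR)) (by positivity : 0 ≤ 8 * A * τ)
    have s2 := mul_le_mul_of_nonneg_left hr (sq_nonneg G)
    have s3 := mul_le_mul_of_nonneg_left hρC (by positivity : 0 ≤ G ^ 2 / τ ^ 2)
    have e3 : G ^ 2 / τ ^ 2 * (C * τ ^ 3) = G ^ 2 * C * τ := by field_simp
    rw [e3] at s3
    unfold lowSq at s2 s3
    linarith
  · intro k hk
    have hwk : coeff w k = coeff b k + (θ' * τ : ℝ) * F k + ρ k := by rw [hρ]; ring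
    have hτ' : (τ : ℂ) ≠ 0 := by exact_mod_cast hτ0.ne'
    rw [coeff_cutoff_SL w hk, hwk, hb, coeff_cutoff_SL v hk, hhalf, ← hm, hvr k hk, add_mul θ θ' τ,
      heat_add, ← hF]
    simp only [hmm]
    push_cast
    field_simp
    ring

end AllenCahnSplitting

end

/-! ### Energy dissipation and coercivity -/

noncomputable section

namespace AllenCahnSplitting

open MeasureTheory Set AddCircle ComplexConjugate

/-- The Ginzburg–Landau energy, with respect to the normalized measure, of a trigonometric
polynomial of degree at most `M`. -/
def energy (ν : ℝ) (M : ℕ) (u : Torus → ℝ) : ℝ :=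
  ν / 2 * ∑ k ∈ modes M, (k : ℝ) ^ 2 * ‖coeff u k‖ ^ 2
    + ∫ x, (u x ^ 2 - 1) ^ 2 / 4 ∂haarAddCircle

/-- The Fourier coefficients of `ν u'' + u - u³`, the negative gradient of the energy. -/
def force (ν : ℝ) (u : Torus → ℝ) (k : ℤ) : ℂ :=
  coeff (fun x => react (u x)) k - (ν * (k : ℝ) ^ 2 : ℝ) * coeff u k

lemma integral_quartic_sub_le {M : ℕ} {u v : Torus → ℝ} (hu : IsTrig M u) (hv : IsTrig M v)
    {B : ℝ} (huB : ∀ x, |u x| ≤ B) (hvB : ∀ x, |v x| ≤ B) :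
    (∫ x, (v x ^ 2 - 1) ^ 2 / 4 ∂haarAddCircle) - ∫ x, (u x ^ 2 - 1) ^ 2 / 4 ∂haarAddCircle
      ≤ ∑ k ∈ modes M, (-(conj (coeff (fun x => react (u x)) k) * (coeff v k - coeff u k)).re
        + 3 / 2 * B ^ 2 * ‖coeff v k - coeff u k‖ ^ 2) := by
  have huc := hu.continuous
  have hvc := hv.continuous
  have hrc : Continuous fun x => react (u x) := by fun_prop
  have h1 : ∫ x, react (u x) * (v x - u x) ∂haarAddCircle = ∑ k ∈ modes M,
      (conj (coeff (fun x => react (u x)) k) * (coeff v k - coeff u k)).re := by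
    simp_rw [mul_sub, Complex.sub_re]
    rw [integral_sub (integrable_of_continuous (by fun_prop))
      (integrable_of_continuous (by fun_prop)), hv.integral_mul hrc, hu.integral_mul hrc,
      Finset.sum_sub_distrib]
  rw [Finset.sum_add_distrib, Finset.sum_neg_distrib, ← Finset.mul_sum, ← h1]
  have h2 := hu.lowSq_sub_eq hv
  unfold lowSq at h2
  rw [← h2, ← integral_const_mul, ← integral_neg, ← integral_add, ← integral_sub]
  rotate_left
  all_goals try exact integrable_of_continuous (by fun_prop)
  refine integral_mono (integrable_of_continuous (by fun_prop))
    (integrable_of_continuous (by fun_prop)) fun x => ?_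
  -- Exact second-order expansion of the quartic; the bracket over `4` is at most `(4B² + 2B²)/4`,
  -- giving `3/2 * B ^ 2`.
  have e : (v x ^ 2 - 1) ^ 2 / 4 - (u x ^ 2 - 1) ^ 2 / 4 = -(react (u x) * (v x - u x))
      + ((u x + v x) ^ 2 + 2 * u x ^ 2 - 2) / 4 * (v x - u x) ^ 2 := by
    unfold react; ring
  simp only [e]
  gcongr
  obtain ⟨a1, a2⟩ := abs_le.1 (huB x)
  obtain ⟨b1, b2⟩ := abs_le.1 (hvB x)
  have hs : (u x + v x) ^ 2 ≤ (2 * B) ^ 2 := sq_le_sq' (by linarith) (by linarith)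
  have hu2 : u x ^ 2 ≤ B ^ 2 := sq_le_sq' a1 a2
  linarith

lemma energy_sub_le {ν : ℝ} {M : ℕ} {u v : Torus → ℝ} (hu : IsTrig M u) (hv : IsTrig M v)
    {B : ℝ} (huB : ∀ x, |u x| ≤ B) (hvB : ∀ x, |v x| ≤ B) :
    energy ν M v - energy ν M u ≤ ∑ k ∈ modes M, (-(conj (force ν u k) * (coeff v k - coeff u k)).re
      + (ν * (k : ℝ) ^ 2 / 2 + 3 / 2 * B ^ 2) * ‖coeff v k - coeff u k‖ ^ 2) := by
  have h := integral_quartic_sub_le hu hv huB hvB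
  have e : ν / 2 * ∑ k ∈ modes M, (k : ℝ) ^ 2 * ‖coeff v k‖ ^ 2
      - ν / 2 * ∑ k ∈ modes M, (k : ℝ) ^ 2 * ‖coeff u k‖ ^ 2
      = ∑ k ∈ modes M, ν * (k : ℝ) ^ 2 / 2 * (‖coeff v k‖ ^ 2 - ‖coeff u k‖ ^ 2) := by
    rw [Finset.mul_sum, Finset.mul_sum, ← Finset.sum_sub_distrib]
    exact Finset.sum_congr rfl fun k _ => by ring
  calc energy ν M v - energy ν M u
      ≤ ∑ k ∈ modes M, ν * (k : ℝ) ^ 2 / 2 * (‖coeff v k‖ ^ 2 - ‖coeff u k‖ ^ 2)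
        + ∑ k ∈ modes M, (-(conj (coeff (fun x => react (u x)) k) * (coeff v k - coeff u k)).re
          + 3 / 2 * B ^ 2 * ‖coeff v k - coeff u k‖ ^ 2) := by
        unfold energy; linarith
    _ = _ := by
        rw [← Finset.sum_add_distrib]
        refine Finset.sum_congr rfl fun k _ => ?_
        unfold force
        simp only [← Complex.normSq_eq_norm_sq, Complex.normSq_apply, Complex.mul_re,
          Complex.sub_re, Complex.sub_im, Complex.conj_re, Complex.conj_im, Complex.mul_im,
          Complex.ofReal_re, Complex.ofReal_im]
        ring

lemma exists_exp_quotient {Λ x : ℝ} (hx : 0 ≤ x) (hxΛ : x ≤ Λ) :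
    ∃ φ : ℝ, x * φ = 1 - Real.exp (-x) ∧ Real.exp (-Λ) ≤ φ ∧ φ ≤ 1 ∧ (1 - φ) ^ 2 ≤ x := by
  have hΛ : Real.exp (-Λ) ≤ Real.exp (-x) := Real.exp_le_exp.2 (by linarith)
  rcases hx.eq_or_lt with rfl | hx0
  · exact ⟨1, by simp, by simpa using hxΛ, le_rfl, by simp⟩
  · have h1 := Real.add_one_le_exp (-x)
    have h2 : Real.exp (-x) ≤ (1 - Real.exp (-x)) / x := by
      have h3 := Real.add_one_le_exp x
      have h4 : Real.exp x * Real.exp (-x) = 1 := by rw [← Real.exp_add]; simp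
      rw [le_div_iff₀ hx0]
      nlinarith [Real.exp_pos (-x)]
    have h3 : (1 - Real.exp (-x)) / x ≤ 1 := by rw [div_le_one hx0]; linarith
    refine ⟨(1 - Real.exp (-x)) / x, by field_simp, hΛ.trans h2, h3, ?_⟩
    have := Real.exp_pos (-x)
    nlinarith

/-- Of the gain `φ|g|²`, the stiff quadratic term takes one half by `qτφ ≤ 1`, and the `C` term a
tenth by `Cτ ≤ 1/10`. The cross terms total `11/5 |g||e|`, and Young's inequality charges half of
the remaining `2/5` for them. -/
lemma mode_dissipation {g e : ℂ} {q C τ Λ φ φ₀ : ℝ} (hτ : 0 < τ) (hq : 0 ≤ q) (hC : 0 ≤ C)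
    (hCτ : C * τ ≤ 1 / 10) (hφ₀ : 0 < φ₀) (hφ : φ₀ ≤ φ) (hφ1 : φ ≤ 1) (hqφ : q * τ * φ ≤ 1)
    (hqΛ : q * τ ≤ Λ) :
    -(conj g * ((τ * φ : ℝ) * g + τ * e)).re + (q / 2 + C) * ‖(τ * φ : ℝ) * g + τ * e‖ ^ 2
      ≤ τ * (-(φ₀ / 5) * ‖g‖ ^ 2 + (Λ / 2 + 1 + 7 / φ₀) * ‖e‖ ^ 2) := by
  have hφpos : 0 < φ := hφ₀.trans_le hφ
  set a := ‖g‖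
  set b := ‖e‖
  have ha : 0 ≤ a := norm_nonneg g
  have hb : 0 ≤ b := norm_nonneg e
  have h1 : (conj g * ((τ * φ : ℝ) * g + τ * e)).re = τ * φ * a ^ 2 + τ * (conj g * e).re := by
    have : conj g * ((τ * φ : ℝ) * g + τ * e)
        = ((τ * φ : ℝ) : ℂ) * (g * conj g) + (τ : ℂ) * (conj g * e) := by ring
    rw [this, Complex.mul_conj, Complex.normSq_eq_norm_sq, Complex.add_re, Complex.re_ofReal_mul,
      Complex.re_ofReal_mul, Complex.ofReal_re]
  have h2 : -(a * b) ≤ (conj g * e).re := by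
    have := Complex.abs_re_le_norm (conj g * e)
    rw [norm_mul, Complex.norm_conj] at this
    exact (abs_le.1 this).1
  have h3 : ‖(τ * φ : ℝ) * g + τ * e‖ ^ 2 ≤ (τ * (φ * a + b)) ^ 2 := by
    refine pow_le_pow_left₀ (norm_nonneg _) ((norm_add_le _ _).trans (le_of_eq ?_)) 2
    rw [norm_mul, norm_mul, Complex.norm_real, Complex.norm_real, Real.norm_of_nonneg hτ.le,
      Real.norm_of_nonneg (by positivity)]
    ring
  have h4 := mul_le_mul_of_nonneg_left h3 (by positivity : 0 ≤ q / 2 + C)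
  have hx0 : 0 ≤ q * τ := by positivity
  have h5 : q * τ / 2 * (φ * a + b) ^ 2 ≤ φ * a ^ 2 / 2 + a * b + Λ / 2 * b ^ 2 := by
    have i1 := mul_le_mul_of_nonneg_right hqφ (by positivity : 0 ≤ φ * a ^ 2 / 2 + a * b)
    have i2 := mul_le_mul_of_nonneg_right hqΛ (by positivity : 0 ≤ b ^ 2 / 2)
    nlinarith
  have h6 : C * τ * (φ * a + b) ^ 2 ≤ φ * a ^ 2 / 10 + a * b / 5 + b ^ 2 / 10 := by
    have i1 := mul_le_mul_of_nonneg_right hCτ (sq_nonneg (φ * a + b))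
    have i2 := mul_le_mul_of_nonneg_right hφ1 (by positivity : 0 ≤ φ * a ^ 2)
    have i3 := mul_le_mul_of_nonneg_right hφ1 (by positivity : 0 ≤ a * b)
    nlinarith
  have h7 : 11 / 5 * (a * b) ≤ φ₀ / 5 * a ^ 2 + 7 / φ₀ * b ^ 2 := by
    have e : φ₀ / 5 * a ^ 2 + 7 / φ₀ * b ^ 2 - 11 / 5 * (a * b)
        = (1 / (5 * φ₀)) * ((φ₀ * a - 11 / 2 * b) ^ 2 + 19 / 4 * b ^ 2) := by
      field_simp; ring
    have : 0 ≤ (1 / (5 * φ₀)) * ((φ₀ * a - 11 / 2 * b) ^ 2 + 19 / 4 * b ^ 2) := by positivity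
    linarith
  have h8 := mul_le_mul_of_nonneg_right hφ (sq_nonneg a)
  have h9 : -(φ * a ^ 2) + a * b + (q * τ / 2 * (φ * a + b) ^ 2 + C * τ * (φ * a + b) ^ 2)
      ≤ -(φ₀ / 5) * a ^ 2 + (Λ / 2 + 1 + 7 / φ₀) * b ^ 2 := by
    nlinarith [sq_nonneg b]
  have h10 := mul_le_mul_of_nonneg_left h9 hτ.le
  have h11 := mul_le_mul_of_nonneg_left h2 hτ.le
  rw [h1]
  nlinarith

/-- The constant multiplying the squared residual in the energy inequality. -/
def dissConst (Λ : ℝ) : ℝ := Λ / 2 + 1 + 7 / Real.exp (-Λ)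

lemma Approx.energy_sub_le {ν l₀ τ R K B : ℝ} {M : ℕ} {u v : Torus → ℝ} (hν : 0 < ν)
    (hl₀ : 0 < l₀) (hM : 1 ≤ M) (hτ0 : 0 < τ)
    (hτ : τ * (M : ℝ) ^ 2 ≤ l₀) (hu : IsTrig M u) (hR : lowSob M (coeff u) ≤ R)
    (h : Approx ν M τ u 1 K v) (huB : ∀ x, |u x| ≤ B) (hvB : ∀ x, |v x| ≤ B)
    (hBτ : 3 / 2 * B ^ 2 * τ ≤ 1 / 10) :
    energy ν M v - energy ν M u ≤ τ * (-(Real.exp (-(ν * l₀)) / 5) * lowSq M (force ν u)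
      + dissConst (ν * l₀) * (2 * (K + ν * reactSob R)) * τ) := by
  obtain ⟨r, hr, hv⟩ := h.residual
  set F := coeff fun x => react (u x)
  have hP : 0 ≤ dissConst (ν * l₀) := by unfold dissConst; positivity
  refine (AllenCahnSplitting.energy_sub_le hu h.isTrig huB hvB).trans ?_
  have hk : ∀ k ∈ modes M, -(conj (force ν u k) * (coeff v k - coeff u k)).re
      + (ν * (k : ℝ) ^ 2 / 2 + 3 / 2 * B ^ 2) * ‖coeff v k - coeff u k‖ ^ 2
      ≤ τ * (-(Real.exp (-(ν * l₀)) / 5) * ‖force ν u k‖ ^ 2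
        + dissConst (ν * l₀) * (2 * (‖r k‖ ^ 2 + ν * τ * ((k : ℝ) ^ 2 * ‖F k‖ ^ 2)))) := by
    intro k hk
    obtain ⟨φ, hφ, hφ0, hφ1, hφ2⟩ := exists_exp_quotient (x := ν * τ * (k : ℝ) ^ 2)
      (by positivity) (freq_le hν hτ0 hτ hk)
    have hheat : heat ν (1 * τ) k = 1 - ν * τ * (k : ℝ) ^ 2 * φ := by
      rw [hφ, heat, one_mul]; ring
    -- The heat increment `-xφû` combines with `τφF` to `τφ` times the force; the leftover `(1 -
    -- φ)F` is small since `(1 - φ)² ≤ x` and `F` is bounded in `H¹`.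
    have e : coeff v k - coeff u k
        = (τ * φ : ℝ) * force ν u k + τ * (r k + (1 - φ : ℝ) * F k) := by
      rw [hv k hk, hheat, force]; push_cast; ring
    rw [e]
    have hd := mode_dissipation (g := force ν u k) (e := r k + (1 - φ : ℝ) * F k)
      (q := ν * (k : ℝ) ^ 2) (Λ := ν * l₀) hτ0 (by positivity) (by positivity) hBτ (Real.exp_pos _) hφ0 hφ1
      (by linarith [Real.exp_pos (-(ν * τ * (k : ℝ) ^ 2))])
      (by linarith [freq_le hν hτ0 hτ hk])
    refine hd.trans ?_
    have he : ‖r k + (1 - φ : ℝ) * F k‖ ^ 2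
        ≤ 2 * (‖r k‖ ^ 2 + ν * τ * ((k : ℝ) ^ 2 * ‖F k‖ ^ 2)) := by
      refine (norm_add_sq_le _ _).trans ?_
      rw [norm_ofReal_mul_sq]
      have := mul_le_mul_of_nonneg_right hφ2 (sq_nonneg ‖F k‖)
      linarith
    have := mul_le_mul_of_nonneg_left he hP
    unfold dissConst at *
    gcongr τ * ?_
    linarith
  refine (Finset.sum_le_sum hk).trans ?_
  rw [← Finset.mul_sum, Finset.sum_add_distrib, ← Finset.mul_sum, ← Finset.mul_sum,
    ← Finset.mul_sum, Finset.sum_add_distrib, ← Finset.mul_sum]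
  have s1 := mul_le_mul_of_nonneg_left ((sum_sq_mul_le_lowSob M F).trans
      (hu.lowSob_react_le hM hR)) (by positivity : 0 ≤ ν * τ)
  unfold lowSq at *
  have s2 : 2 * (∑ k ∈ modes M, ‖r k‖ ^ 2 + ν * τ * ∑ k ∈ modes M, (k : ℝ) ^ 2 * ‖F k‖ ^ 2)
      ≤ 2 * (K + ν * reactSob R) * τ := by linarith
  have s3 := mul_le_mul_of_nonneg_left s2 hP
  gcongr τ * ?_
  linarith

/-- Pairing the force with `u` bounds the Dirichlet term by `∫ (u² - u⁴)` plus a Young remainder;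
the negative quartic dominates both `u²` and the double-well potential. -/
lemma energy_le_one_of_force {ν : ℝ} {M : ℕ} {u : Torus → ℝ} (hu : IsTrig M u)
    (hg : lowSq M (force ν u) ≤ 1) : energy ν M u ≤ 1 := by
  have huc := hu.continuous
  have h1 : ∑ k ∈ modes M, (conj (force ν u k) * coeff u k).re
      = ∫ x, react (u x) * u x ∂haarAddCircle
        - ν * ∑ k ∈ modes M, (k : ℝ) ^ 2 * ‖coeff u k‖ ^ 2 := by
    rw [hu.integral_mul (by fun_prop), Finset.mul_sum, ← Finset.sum_sub_distrib]
    refine Finset.sum_congr rfl fun k _ => ?_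
    unfold force
    simp only [← Complex.normSq_eq_norm_sq, Complex.normSq_apply, Complex.mul_re,
      Complex.sub_re, Complex.sub_im, Complex.conj_re, Complex.conj_im, Complex.mul_im,
      Complex.ofReal_re, Complex.ofReal_im]
    ring
  have h2 : -(1 / 2 * lowSq M (force ν u) + 1 / 2 * ∑ k ∈ modes M, ‖coeff u k‖ ^ 2)
      ≤ ∑ k ∈ modes M, (conj (force ν u k) * coeff u k).re := by
    rw [lowSq, Finset.mul_sum, Finset.mul_sum, ← Finset.sum_add_distrib, ← Finset.sum_neg_distrib]
    refine Finset.sum_le_sum fun k _ => ?_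
    have := Complex.abs_re_le_norm (conj (force ν u k) * coeff u k)
    rw [norm_mul, Complex.norm_conj] at this
    nlinarith [(abs_le.1 this).1, sq_nonneg (‖force ν u k‖ - ‖coeff u k‖)]
  rw [← hu.integral_sq] at h2
  have h3 : 1 / 2 * (∫ x, react (u x) * u x ∂haarAddCircle)
      + 1 / 4 * (∫ x, u x ^ 2 ∂haarAddCircle) + ∫ x, (u x ^ 2 - 1) ^ 2 / 4 ∂haarAddCircle
      ≤ 1 / 2 := by
    rw [← integral_const_mul, ← integral_const_mul, ← integral_add, ← integral_add]
    rotate_left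
    all_goals try exact integrable_of_continuous (by fun_prop)
    refine integral_le_of_le (by fun_prop) fun x => ?_
    unfold react
    nlinarith [sq_nonneg (u x ^ 2 - 1 / 2)]
  unfold energy
  linarith

lemma integral_quartic_nonneg (u : Torus → ℝ) :
    0 ≤ ∫ x, (u x ^ 2 - 1) ^ 2 / 4 ∂haarAddCircle :=
  integral_nonneg fun _ => by positivity

lemma IsTrig.integral_sq_le {ν K : ℝ} (hν : 0 < ν) {M : ℕ} {u : Torus → ℝ} (hu : IsTrig M u)
    (hE : energy ν M u ≤ K) : lowSq M (coeff u) ≤ 2 + K := by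
  have huc := hu.continuous
  rw [lowSq, ← hu.integral_sq]
  have h1 : ∫ x, u x ^ 2 ∂haarAddCircle - ∫ x, (u x ^ 2 - 1) ^ 2 / 4 ∂haarAddCircle ≤ 2 := by
    rw [← integral_sub (integrable_of_continuous (by fun_prop))
      (integrable_of_continuous (by fun_prop))]
    refine integral_le_of_le (by fun_prop) fun x => ?_
    -- Completing the square: `(u² - 1)²/4 - u² + 2 = (u² - 3)²/4`.
    nlinarith [sq_nonneg (u x ^ 2 - 3)]
  have h2 : 0 ≤ ν / 2 * ∑ k ∈ modes M, (k : ℝ) ^ 2 * ‖coeff u k‖ ^ 2 := by positivity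
  unfold energy at hE
  linarith

/-- The bound of the `H¹` norm by the energy. -/
def sobBound (ν K : ℝ) : ℝ := 2 + K + 2 * K / ν

lemma IsTrig.lowSob_le_of_energy {ν K : ℝ} (hν : 0 < ν) {M : ℕ} {u : Torus → ℝ}
    (hu : IsTrig M u) (hE : energy ν M u ≤ K) : lowSob M (coeff u) ≤ sobBound ν K := by
  rw [lowSob_eq, sobBound]
  refine add_le_add (hu.integral_sq_le hν hE) ?_
  rw [le_div_iff₀ hν]
  have := integral_quartic_nonneg u
  unfold energy at hE
  linarith

lemma IsTrig.energy_le_of_lowSob {ν R : ℝ} (hν : 0 < ν) {M : ℕ} {u : Torus → ℝ}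
    (hu : IsTrig M u) (hR : lowSob M (coeff u) ≤ R) :
    energy ν M u ≤ ν / 2 * R + (√(sobConst * R) ^ 4 + 1) / 4 := by
  have huc := hu.continuous
  unfold energy
  refine add_le_add ?_ (integral_le_of_le (by fun_prop) fun x => ?_)
  · have := (sum_sq_mul_le_lowSob M (coeff u)).trans hR
    gcongr
  · have h := pow_le_pow_left₀ (abs_nonneg _) (hu.abs_le_of_lowSob hR x) 2
    rw [sq_abs] at h
    nlinarith [sq_nonneg (u x)]

end AllenCahnSplitting

end

/-! ### The composed scheme and its invariant energy sublevels -/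

noncomputable section

namespace AllenCahnSplitting

open MeasureTheory Set AddCircle ComplexConjugate

/-- The value `4/3` is exactly the threshold for `x₀ ≤ 2`. -/
lemma two_rpow_third_le : (2 : ℝ) ^ (1 / 3 : ℝ) ≤ 4 / 3 := by
  have h : ((2 : ℝ) ^ (1 / 3 : ℝ)) ^ 3 = 2 := by
    rw [← Real.rpow_natCast, ← Real.rpow_mul (by norm_num)]
    norm_num
  by_contra! hc
  have := pow_lt_pow_left₀ hc (by norm_num) (n := 3) (by norm_num)
  rw [h] at this
  norm_num at this

lemma two_rpow_third_pos : 0 < (2 : ℝ) ^ (1 / 3 : ℝ) := by positivity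

lemma abs_x₀_le : |x₀| ≤ 2 := by
  have h1 := two_rpow_third_le
  have h2 := two_rpow_third_pos
  have h3 : 0 < 2 - (2 : ℝ) ^ (1 / 3 : ℝ) := by linarith
  rw [x₀, abs_of_nonneg (by positivity), div_le_iff₀ h3]
  linarith

lemma abs_x₁_le : |x₁| ≤ 2 := by
  have h1 := two_rpow_third_le
  have h3 : 0 < 2 - (2 : ℝ) ^ (1 / 3 : ℝ) := by linarith
  rw [x₁, abs_of_nonneg (by positivity), div_le_iff₀ h3]
  linarith

/-- The only order condition used; the cubic one behind fourth-order accuracy plays no role. -/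
lemma x₁_sub_x₀_add_x₁ : x₁ + -x₀ + x₁ = 1 := by
  have h1 := two_rpow_third_le
  have h3 : 2 - (2 : ℝ) ^ (1 / 3 : ℝ) ≠ 0 := by linarith
  rw [x₁, x₀]
  field_simp
  ring

lemma abs_x₁_sub_x₀_le : |x₁ + -x₀| ≤ 2 := by
  have h := x₁_sub_x₀_add_x₁
  have h1 := abs_le.1 abs_x₁_le
  have h2 : 0 ≤ x₁ := by
    have := two_rpow_third_le
    have : 0 < 2 - (2 : ℝ) ^ (1 / 3 : ℝ) := by linarith
    unfold x₁; positivity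
  rw [abs_le]
  constructor <;> linarith

lemma IsS4.unique {ν : ℝ} {M : ℕ} {τ : ℝ} {u v v' : Torus → ℝ} (h : IsS4 ν M τ u v)
    (h' : IsS4 ν M τ u v') : v = v' := by
  obtain ⟨p, q, h1, h2, h3⟩ := h
  obtain ⟨p', q', h1', h2', h3'⟩ := h'
  obtain rfl := h1.unique h1'
  obtain rfl := h2.unique h2'
  exact h3.unique h3'

/-- One step of the fourth order splitting agrees with exponential Euler up to `O(τ^{3/2})`. -/
lemma exists_isS4_approx {ν l₀ R : ℝ} (hν : 0 < ν) (hl₀ : 0 < l₀) (hR0 : 0 ≤ R) :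
    ∃ τ₀ K : ℝ, 0 < τ₀ ∧ 0 ≤ K ∧ ∀ (M : ℕ) (τ : ℝ) (u : Torus → ℝ), 1 ≤ M → 0 < τ → τ ≤ τ₀ →
      τ * (M : ℝ) ^ 2 ≤ l₀ → IsTrig M u → lowSob M (coeff u) ≤ R →
      ∃ v, IsS4 ν M τ u v ∧ Approx ν M τ u 1 K v := by
  obtain ⟨τ₁, K₁, hτ₁, hK₁, h₁⟩ := Approx.step (θ := 0) (θ' := x₁) hν hl₀ hR0 le_rfl (by simp)
    abs_x₁_le
  obtain ⟨τ₂, K₂, hτ₂, hK₂, h₂⟩ := Approx.step (θ := 0 + x₁) (θ' := -x₀) hν hl₀ hR0 hK₁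
    (by simpa using abs_x₁_le) (by simpa using abs_x₀_le)
  obtain ⟨τ₃, K₃, hτ₃, hK₃, h₃⟩ := Approx.step (θ := 0 + x₁ + -x₀) (θ' := x₁) hν hl₀ hR0 hK₂
    (by simpa using abs_x₁_sub_x₀_le) abs_x₁_le
  refine ⟨min τ₁ (min τ₂ τ₃), K₃, lt_min hτ₁ (lt_min hτ₂ hτ₃), hK₃, ?_⟩
  intro M τ u hM hτ0 hτ₀ hτ hu hR
  have hle₂ : τ ≤ τ₂ := hτ₀.trans ((min_le_right _ _).trans (min_le_left _ _))
  have hle₃ : τ ≤ τ₃ := hτ₀.trans ((min_le_right _ _).trans (min_le_right _ _))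
  obtain ⟨p, hp, hpA⟩ := h₁ M τ u u hM hτ0 (hτ₀.trans (min_le_left _ _)) hτ hu hR (Approx.refl hu)
  obtain ⟨q, hq, hqA⟩ := h₂ M τ u p hM hτ0 hle₂ hτ hu hR hpA
  obtain ⟨v, hv, hvA⟩ := h₃ M τ u q hM hτ0 hle₃ hτ hu hR hqA
  refine ⟨v, ⟨p, q, hp, hq, hv⟩, ?_⟩
  rwa [zero_add, x₁_sub_x₀_add_x₁] at hvA

/-- Sublevel sets of the energy above the level `2` are invariant under the splitting scheme. -/
lemma exists_isS4_energy_le {ν l₀ E : ℝ} (hν : 0 < ν) (hl₀ : 0 < l₀) (hE : 2 ≤ E) :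
    ∃ τ₀ : ℝ, 0 < τ₀ ∧ ∀ (M : ℕ) (τ : ℝ) (u : Torus → ℝ), 1 ≤ M → 0 < τ → τ ≤ τ₀ →
      τ * (M : ℝ) ^ 2 ≤ l₀ → IsTrig M u → energy ν M u ≤ E →
      ∃ v, IsS4 ν M τ u v ∧ IsTrig M v ∧ energy ν M v ≤ E := by
  set R := sobBound ν E with hRdef
  have hR0 : 0 ≤ R := by rw [hRdef, sobBound]; positivity
  obtain ⟨τ₁, K, hτ₁, hK, h⟩ := exists_isS4_approx hν hl₀ hR0
  set D := devConst ν l₀ R K with hD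
  have hRS : 0 ≤ reactSob R := by unfold reactSob; positivity
  have hD0 : 0 ≤ D := by
    have := heatConst_nonneg hν hl₀
    rw [hD, devConst]; positivity
  set B := supConst l₀ R D
  set c := Real.exp (-(ν * l₀)) / 5 with hc
  have hc0 : 0 < c := by positivity
  set Q := dissConst (ν * l₀) * (2 * (K + ν * reactSob R)) with hQ
  have hQ0 : 0 ≤ Q := by
    have : 0 ≤ dissConst (ν * l₀) := by unfold dissConst; positivity
    positivity
  -- The third bound makes `3/2 B² τ ≤ 1/10`; the last gives `Qτ ≤ c`, for descent when the force is
  -- large, and `Qτ ≤ 1`, for a gain of at most `1` when it is small.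
  refine ⟨min (min 1 τ₁) (min (1 / (10 * (3 / 2 * B ^ 2 + 1))) (min c 1 / (Q + 1))),
    by positivity, ?_⟩
  intro M τ u hM hτ0 hτ₀ hτ hu huE
  obtain ⟨⟨hτ1, hle₁⟩, hle₂, hle₃⟩ : (τ ≤ 1 ∧ τ ≤ τ₁) ∧ τ ≤ 1 / (10 * (3 / 2 * B ^ 2 + 1)) ∧
      τ ≤ min c 1 / (Q + 1) := by simpa only [le_min_iff] using hτ₀
  have hR := hu.lowSob_le_of_energy hν huE
  obtain ⟨v, hv, hvA⟩ := h M τ u hM hτ0 hle₁ hτ hu hR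
  refine ⟨v, hv, hvA.isTrig, ?_⟩
  have hdev := hvA.lowSq_sub_le hν hl₀ hM hτ0 hτ1 hτ hu hR (by norm_num) hK
  have hvB := hvA.isTrig.abs_le_supConst hM hτ hR hD0 hdev
  have huB := hu.abs_le_supConst hM hτ hR hD0 (by
    simp only [lowSq, sub_self, norm_zero]
    simpa using mul_nonneg hD0 hτ0.le)
  have hBτ : 3 / 2 * B ^ 2 * τ ≤ 1 / 10 := by
    rw [le_div_iff₀ (by positivity)] at hle₂
    nlinarith
  have hdiff : energy ν M v - energy ν M u ≤ τ * (-c * lowSq M (force ν u) + Q * τ) :=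
    hvA.energy_sub_le hν hl₀ hM hτ0 hτ hu hR huB hvB hBτ
  rw [le_div_iff₀ (by positivity)] at hle₃
  have hQc : Q * τ ≤ c := by nlinarith [min_le_left c 1]
  have hQ1 : Q * τ ≤ 1 := by nlinarith [min_le_right c 1]
  -- Small force: the old energy is at most `1` and the step adds at most `1`, which is why `2 ≤ E`
  -- is needed. Large force: dissipation beats the error.
  by_cases hg : lowSq M (force ν u) ≤ 1
  · have h1 := energy_le_one_of_force hu hg
    have h2 : τ * (-c * lowSq M (force ν u) + Q * τ) ≤ 1 := by
      have := mul_nonneg hc0.le (lowSq_nonneg M (force ν u))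
      calc _ ≤ τ * 1 := by gcongr; linarith
        _ ≤ 1 := by linarith
    linarith
  · have h2 : τ * (-c * lowSq M (force ν u) + Q * τ) ≤ 0 := by
      refine mul_nonpos_of_nonneg_of_nonpos hτ0.le ?_
      nlinarith [not_le.1 hg]
    linarith

/-! ### Return to the full `H¹` norm and to orbits -/

lemma normH1_sq {f : Torus → ℝ} :
    normH1 f ^ 2 = 2 * π * (∫ x, f x ^ 2 ∂haarAddCircle
      + ∑' k : ℤ, (k : ℝ) ^ 2 * ‖coeff f k‖ ^ 2) := by
  have h1 : 0 ≤ ∫ x, f x ^ 2 := integral_nonneg fun x => sq_nonneg (f x)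
  have h2 : 0 ≤ ∑' k : ℤ, (k : ℝ) ^ 2 * ‖coeff f k‖ ^ 2 := tsum_nonneg fun _ => by positivity
  rw [normH1, Real.sq_sqrt (by positivity), integral_haar_eq, mul_add]

lemma lowSob_coeff_le {f : Torus → ℝ} (hf : MemH1 f) (M : ℕ) :
    lowSob M (coeff f) ≤ normH1 f ^ 2 := by
  have h0 : 0 ≤ ∫ x, f x ^ 2 ∂haarAddCircle
      + ∑' k : ℤ, (k : ℝ) ^ 2 * ‖coeff f k‖ ^ 2 :=
    add_nonneg (integral_nonneg fun x => sq_nonneg (f x)) (tsum_nonneg fun _ => by positivity)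
  rw [normH1_sq, lowSob_eq]
  have h1 := add_le_add (sum_sq_coeff_le hf.1 (modes M))
    (hf.2.sum_le_tsum (modes M) fun _ _ => by positivity)
  refine h1.trans (le_mul_of_one_le_left h0 ?_)
  linarith [Real.pi_gt_three]

lemma IsTrig.memH1 {M : ℕ} {u : Torus → ℝ} (hu : IsTrig M u) : MemH1 u :=
  ⟨memLp_of_continuous hu.continuous, summable_of_ne_finset_zero (s := modes M) fun k hk => by
    simp [hu.coeff_eq_zero hk]⟩

lemma IsTrig.normH1_sq_eq {M : ℕ} {u : Torus → ℝ} (hu : IsTrig M u) :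
    normH1 u ^ 2 = 2 * π * lowSob M (coeff u) := by
  rw [normH1_sq, hu.integral_sq, lowSob_eq, lowSq,
    tsum_eq_sum (s := modes M) fun k hk => by simp [hu.coeff_eq_zero hk]]

lemma isTrig_proj (M : ℕ) (a : Torus → ℝ) : IsTrig M (proj M a) :=
  isTrig_cutoff (conjSymm_coeff a)

lemma lowSob_coeff_proj (M : ℕ) (a : Torus → ℝ) :
    lowSob M (coeff (proj M a)) = lowSob M (coeff a) :=
  Finset.sum_congr rfl fun k hk => by rw [proj, coeff_cutoff (conjSymm_coeff a), if_pos hk]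

/-- `IsS4` is a relation, so its uniqueness is needed to identify the orbit's next iterate with the
successor known to satisfy `P`. -/
lemma IsOrbit.invariant {ν τ : ℝ} {M : ℕ} {a : Torus → ℝ} {u : ℕ → Torus → ℝ}
    (h : IsOrbit ν M τ a u) {P : (Torus → ℝ) → Prop} (h0 : P (proj M a))
    (hP : ∀ v, P v → ∃ w, IsS4 ν M τ v w ∧ P w) (n : ℕ) : P (u n) := by
  induction n with
  | zero => rw [h.1]; exact h0
  | succ n ih =>
    obtain ⟨w, hw, hPw⟩ := hP _ ih
    rwa [(h.2 n).unique hw]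

lemma existsUnique_isOrbit {ν τ : ℝ} {M : ℕ} {a : Torus → ℝ} {P : (Torus → ℝ) → Prop}
    (h0 : P (proj M a)) (hP : ∀ v, P v → ∃ w, IsS4 ν M τ v w ∧ P w) :
    ∃! u : ℕ → Torus → ℝ, IsOrbit ν M τ a u := by
  choose! S hS hSP using hP
  have hPn : ∀ n, P (S^[n] (proj M a)) := fun n => by
    induction n with
    | zero => exact h0
    | succ n ih => rw [Function.iterate_succ_apply']; exact hSP _ ih
  refine ⟨fun n => S^[n] (proj M a), ⟨rfl, fun n => ?_⟩, fun u hu => funext fun n => ?_⟩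
  · simp only [Function.iterate_succ_apply']
    exact hS _ (hPn n)
  · induction n with
    | zero => exact hu.1
    | succ n ih =>
      rw [Function.iterate_succ_apply']
      have := hu.2 n
      rw [ih] at this
      exact this.unique (hS _ (hPn n))

end AllenCahnSplitting

end

open AllenCahnSplitting in
/-- The constants `τstar` and `F` depend only on `ν`, `l₀`, `γ₁`; the scheme is well defined for
all steps, and its iterates are bounded in `H¹` uniformly in time. -/
theorem theorem3p1 (ν l₀ γ₁ : ℝ) (hν : 0 < ν) (hl₀ : 0 < l₀) :
    ∃ τstar F : ℝ, 0 < τstar ∧ 0 < F ∧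
      ∀ (M : ℕ) (τ : ℝ), 2 ≤ M → 0 < τ → τ ≤ l₀ * ((M : ℝ) ^ 2)⁻¹ → τ ≤ τstar →
        ∀ a : AllenCahnSplitting.Torus → ℝ,
          AllenCahnSplitting.MemH1 a → AllenCahnSplitting.normH1 a ≤ γ₁ →
          (∃! u : ℕ → AllenCahnSplitting.Torus → ℝ, AllenCahnSplitting.IsOrbit ν M τ a u) ∧
          ∀ u : ℕ → AllenCahnSplitting.Torus → ℝ, AllenCahnSplitting.IsOrbit ν M τ a u →
            ∀ n : ℕ, 1 ≤ n →
              AllenCahnSplitting.MemH1 (u n) ∧ AllenCahnSplitting.normH1 (u n) ≤ F := by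
  -- The level `E` dominates both `2` and the energy of any initial datum with `H¹` norm at most
  -- `γ₁`, so it depends only on `ν` and `γ₁`.
  obtain ⟨E, hE2, hE⟩ : ∃ E : ℝ, 2 ≤ E ∧
      ν / 2 * γ₁ ^ 2 + (√(sobConst * γ₁ ^ 2) ^ 4 + 1) / 4 ≤ E :=
    ⟨max 2 _, le_max_left _ _, le_max_right _ _⟩
  obtain ⟨τ₀, hτ₀, h⟩ := exists_isS4_energy_le hν hl₀ hE2
  have hsob : 0 < sobBound ν E := by unfold sobBound; positivity
  refine ⟨τ₀, √(2 * Real.pi * sobBound ν E), hτ₀, by positivity, ?_⟩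
  intro M τ hM hτ0 hτ hττ₀ a ha haγ
  have hM0 : (0 : ℝ) < (M : ℝ) ^ 2 := by
    have : (2 : ℝ) ≤ M := by exact_mod_cast hM
    positivity
  have hτM : τ * (M : ℝ) ^ 2 ≤ l₀ := by
    rwa [← div_eq_mul_inv, le_div_iff₀ hM0] at hτ
  have ha2 : lowSob M (coeff (proj M a)) ≤ γ₁ ^ 2 := by
    rw [lowSob_coeff_proj]
    exact (lowSob_coeff_le ha M).trans (pow_le_pow_left₀ (Real.sqrt_nonneg _) haγ 2)
  have h0 : IsTrig M (proj M a) ∧ energy ν M (proj M a) ≤ E :=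
    ⟨isTrig_proj M a, ((isTrig_proj M a).energy_le_of_lowSob hν ha2).trans hE⟩
  have hP : ∀ v, (IsTrig M v ∧ energy ν M v ≤ E) →
      ∃ w, IsS4 ν M τ v w ∧ (IsTrig M w ∧ energy ν M w ≤ E) := fun v hv =>
    h M τ v (by omega) hτ0 hττ₀ hτM hv.1 hv.2
  refine ⟨existsUnique_isOrbit h0 hP, fun u hu n _ => ?_⟩
  obtain ⟨hT, hEn⟩ := hu.invariant h0 hP n
  refine ⟨hT.memH1, Real.le_sqrt_of_sq_le ?_⟩
  rw [hT.normH1_sq_eq]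
  have := hT.lowSob_le_of_energy hν hEn
  gcongr
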